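/- Let $H_S$ be a Hermitian operator on $\mathbb{C}^2$ with eigenvalue gap $\Delta>0$. Let the environment be one qubit with Hamiltonian $H_E=\mathrm{diag}(0,\gamma)$, put $H=H_S\otimes 1+1\otimes H_E$, and for a Hamiltonian $K$ write $\rho_K(\beta)=e^{-\beta K}/\mathrm{Tr}\,e^{-\beta K}$. Let $$\Phi(\rho)=\mathrm{Tr}_E\,\mathbb{E}_G\!\left[e^{+i(H+\alpha G)t}\,\big(\rho\otimes\rho_{H_E}(\beta)\big)\,e^{-i(H+\alpha G)t}\right],$$ where $G=UDU^\dagger$ with $U$ a Haar random unitary on $\mathbb{C}^2\otimes\mathbb{C}^2$ and $D$ an independent diagonal matrix with i.i.d. $\mathcal N(0,1)$ entries. For $\sigma>0$, $\varepsilon>0$ and a window $[\gamma-\sigma,\gamma+\sigma]$ containing $\Delta$ (that is, $|\Delta-\gamma|\le\sigma$), put $$\alpha=\frac{1}{t^3(\Delta+\sigma)^2},\qquad t_\pm=\frac1\sigma\sqrt{1\pm\sqrt{1-\frac{2\sigma^2}{\Delta^2\varepsilon}}},$$ $$L=\left\lceil\frac{10}{\alpha^2t^2(1-\sigma^2t^2/2)}\left(2\log\frac{5}{\alpha^2t^2\,\mathrm{sinc}^2(|\Delta-\gamma|t/2)}+4(1+\log2)-\frac12+\log\frac2\varepsilon\right)\right\rceil,$$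 where $\mathrm{sinc}\,x=\sin x/x$ and $\mathrm{sinc}\,0=1$; the value of $L$ is read as $0$ if the expression inside the ceiling is negative. There are universal constants $C>0$ and $k\in\mathbb{N}$ such that the following two statements hold. (1) For every such $H_S$, every density matrix $\rho$ with $[\rho,H_S]=0$, all $\beta\ge0$, $\varepsilon>0$, $\sigma>0$ with $$\sigma\le\min\left\{\frac{\varepsilon}{2\beta},\ \Delta\sqrt{\frac{\varepsilon}{2}}\right\}$$ (where $\varepsilon/(2\beta)=\infty$ if $\beta=0$), every $\gamma$ with $|\Delta-\gamma|\le\sigma$ and every $t\in[t_-,t_+]$, $$\big\|\rho_{H_S}(\beta)-\Phi^{\circ L}(\rho)\big\|_1\le C\,\varepsilon\,(1+|\log\varepsilon|)^k ,$$ where $\|\cdot\|_1$ is the trace norm; that is, the error is $\widetilde O(\varepsilon)$. (2) For all $\Delta>0$ and $0<\varepsilon\le2$ and for all sufficiently small $\sigma>0$ (depending on $\Delta,\varepsilon$), the choice $t=t_-$ satisfies, for every $\gamma$ with $|\Delta-\gamma|\le\sigma$, $$L\cdot t\le\frac{C\,(1+|\log\varepsilon|)^k}{\Delta\,\varepsilon^{2.5}}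 ;$$ that is, as $\sigma\to0$ the total simulation time is $\widetilde O\!\left(1/(\Delta\varepsilon^{2.5})\right)$, with a bound independent of $\beta$. -/

import Mathlib

open MeasureTheory ProbabilityTheory Filter Topology
open scoped Matrix Kronecker ComplexOrder

noncomputable section

namespace Thermalization

variable {n m : Type*} [Fintype n] [DecidableEq n] [Fintype m] [DecidableEq m]

/-! ### Haar measure on the unitary group -/

/-- The unitary group carries its Borel sigma-algebra. -/
instance unitaryMeasurableSpace : MeasurableSpace (Matrix.unitaryGroup n ℂ) := borel _

instance unitaryBorelSpace : BorelSpace (Matrix.unitaryGroup n ℂ) := ⟨rfl⟩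

/-- The unitary group is compact: it is a closed subset of a product of closed discs. -/
instance unitaryCompactSpace : CompactSpace (Matrix.unitaryGroup n ℂ) := by
  suffices h : IsCompact (Matrix.unitaryGroup n ℂ : Set (Matrix n n ℂ)) from
    isCompact_iff_compactSpace.mp h
  have hK : IsCompact {A : Matrix n n ℂ | ∀ i, A i ∈ {v : n → ℂ | ∀ j, v j ∈ Metric.closedBall 0 1}} :=
    isCompact_pi_infinite fun _ => isCompact_pi_infinite fun _ => isCompact_closedBall 0 1
  refine hK.of_isClosed_subset isClosed_unitary fun A hA i j => ?_
  simpa using entry_norm_bound_of_unitary hA i j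

/-- The Haar probability measure on the unitary group. -/
def haarUnitary (n : Type*) [Fintype n] [DecidableEq n] : Measure (Matrix.unitaryGroup n ℂ) :=
  Measure.haarMeasure ⊤

/-- The joint law of Haar distributed eigenvectors `U` and of independent, i.i.d. standard normal
eigenvalues `d`. -/
def interactionLaw (n : Type*) [Fintype n] [DecidableEq n] :
    Measure (Matrix.unitaryGroup n ℂ × (n → ℝ)) :=
  (haarUnitary n).prod (Measure.pi fun _ => gaussianReal 0 1)

/-- The random interaction `G = U D U†`. -/
def interaction (p : Matrix.unitaryGroup n ℂ × (n → ℝ)) : Matrix n n ℂ :=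
  (p.1 : Matrix n n ℂ) * Matrix.diagonal (fun i => (p.2 i : ℂ)) * (p.1 : Matrix n n ℂ)ᴴ

/-! ### States, partial trace, trace norm -/

/-- Density matrices: positive semidefinite of unit trace. -/
def IsDensityMatrix (ρ : Matrix n n ℂ) : Prop := ρ.PosSemidef ∧ ρ.trace = 1

/-- The thermal state `e^{-βH} / Tr e^{-βH}`. -/
def gibbs (H : Matrix n n ℂ) (β : ℝ) : Matrix n n ℂ :=
  (NormedSpace.exp (-(β : ℂ) • H)).trace⁻¹ • NormedSpace.exp (-(β : ℂ) • H)

/-- The partial trace over the second tensor factor. -/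
def partialTraceEnv (X : Matrix (n × m) (n × m) ℂ) : Matrix n n ℂ :=
  Matrix.of fun i j => ∑ k, X (i, k) (j, k)

/-- The trace norm (Schatten 1-norm): the sum of the singular values, that is, of the square roots
of the eigenvalues of `A† A`. -/
def traceNorm (A : Matrix n n ℂ) : ℝ :=
  ∑ i, √((Matrix.isHermitian_conjTranspose_mul_self A).eigenvalues i)

/-! ### The thermalizing channel -/

/-- The uncoupled Hamiltonian `H_S ⊗ 1 + 1 ⊗ H_E`. -/
def totalHamiltonian (HS : Matrix n n ℂ) (HE : Matrix m m ℂ) : Matrix (n × m) (n × m) ℂ :=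
  HS ⊗ₖ (1 : Matrix m m ℂ) + (1 : Matrix n n ℂ) ⊗ₖ HE

/-- Evolution with a fixed interaction: `e^{+i(H + αG)t} X e^{-i(H + αG)t}`. -/
def evolve (H G : Matrix n n ℂ) (α t : ℝ) (X : Matrix n n ℂ) : Matrix n n ℂ :=
  NormedSpace.exp ((Complex.I * t) • (H + (α : ℂ) • G)) * X *
    NormedSpace.exp (-(Complex.I * t) • (H + (α : ℂ) • G))

/-- The thermalizing channel
`Φ(ρ) = Tr_E E_G [e^{+i(H + αG)t} (ρ ⊗ ρ_E(β)) e^{-i(H + αG)t}]`, the expectation over the random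
interaction being taken entry by entry. -/
def channel (HS : Matrix n n ℂ) (HE : Matrix m m ℂ) (α β t : ℝ) (ρ : Matrix n n ℂ) :
    Matrix n n ℂ :=
  partialTraceEnv <| Matrix.of fun a b =>
    ∫ p, evolve (totalHamiltonian HS HE) (interaction p) α t (ρ ⊗ₖ gibbs HE β) a b
      ∂(interactionLaw (n × m))

/-- The environment qubit with gap `γ`: `H_E = diag(0, γ)`. -/
def envHamiltonian (γ : ℝ) : Matrix (Fin 2) (Fin 2) ℂ := !![0, 0; 0, (γ : ℂ)]

/-! ### Single-qubit systems and the parameter choices -/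

/-- The eigenvalue gap of a single-qubit Hamiltonian. -/
def qubitGap {HS : Matrix (Fin 2) (Fin 2) ℂ} (hHS : HS.IsHermitian) : ℝ :=
  |hHS.eigenvalues 0 - hHS.eigenvalues 1|

/-- The coupling constant `α = 1 / (t³ (Δ + σ)²)`. -/
def coupling (Δ σ t : ℝ) : ℝ := 1 / (t ^ 3 * (Δ + σ) ^ 2)

/-- The lower end of the window of interaction times. -/
def timeLower (Δ σ ε : ℝ) : ℝ := 1 / σ * √(1 - √(1 - 2 * σ ^ 2 / (Δ ^ 2 * ε)))

/-- The upper end of the window of interaction times. -/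
def timeUpper (Δ σ ε : ℝ) : ℝ := 1 / σ * √(1 + √(1 - 2 * σ ^ 2 / (Δ ^ 2 * ε)))

/-- The number of interactions. -/
def numInteractions (Δ γ σ ε t : ℝ) : ℕ :=
  ⌈10 / (coupling Δ σ t ^ 2 * t ^ 2 * (1 - σ ^ 2 * t ^ 2 / 2)) *
    (2 * Real.log (5 / (coupling Δ σ t ^ 2 * t ^ 2 * Real.sinc (|Δ - γ| * t / 2) ^ 2))
      + 4 * (1 + Real.log 2) - 1 / 2 + Real.log (2 / ε))⌉₊

end Thermalization

end

open Thermalization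

/-! In an energy eigenbasis the problem becomes a two-level Markov chain. The law of `G` is
invariant under unitary conjugation. Conjugating by diagonal sign matrices shows that the averaged
evolution maps diagonal states to diagonal states (`averageEvolve_diagonal`). Hence `Φ` acts on
states commuting with `H_S` through averaged transition probabilities between the four levels of
system plus environment (`channel_diagonal`, `iterate_channel`).

Write `a = αt`, and let `K` be the fourth moment of the Gaussian eigenvalues. A transition amplitude
is `iαG_{ab} ∫₀ᵗ e^{-iωx} dx` up to an error `‖αG‖²t²`, where `ω` is the energy difference
(`exists_norm_propagator_add_apply_eq`), and `E|G_{ab}|² = 1/5` for `a ≠ b` in dimension four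
(`integral_normSq_interaction`). Only the swap `(1,0) ↔ (0,1)` is nearly resonant, and its
probability is at least `a²(2/45 - εK)`. For small `ε` every other transition has `|ω| ≥ Δ/2`, and
the window for `t` gives `1/Δ² ≤ εt²`, so these have probability `O(εa²)`. The same window gives `a
≤ ε`, which controls the second order remainder.

The swap alone would drive the excited population to `s = sigmoid(-βγ)`, that of the environment.
The rare transitions shift the limit by `O(εa²)/a² = O(ε)` (`rate_bounds`,
`abs_iterate_chainStep_sub_le`), and `L` is large enough that a chain with rate `a²/50` forgets its
start up to `ε` (`log_le_mul_numInteractions`). Replacing `γ` by `Δ` in the thermal population costs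
at most `βσ ≤ ε/2`. For `ε` above a universal threshold the bound holds because two states are at
trace distance at most `2`.

The simulation time follows from `t_-² ≤ 2/(Δ²ε)`, which makes `1/a²` of order `ε⁻²` and `t_-` of
order `1/(Δ√ε)`. -/

noncomputable section

namespace Thermalization

/-! ### Unitary evolution and its second order expansion -/

section Propagator

open scoped Matrix.Norms.L2Operator

variable {n : Type*} [Fintype n] [DecidableEq n]

/-- The unitary `e^{iAt}` generated by `A`. -/
def propagator (A : Matrix n n ℂ) (t : ℝ) : Matrix n n ℂ :=
  NormedSpace.exp ((Complex.I * t) • A)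

lemma propagator_eq_exp_smul (A : Matrix n n ℂ) (t : ℝ) :
    propagator A t = NormedSpace.exp (t • (Complex.I • A)) := by
  rw [propagator, ← Complex.coe_smul, smul_smul, mul_comm]

@[simp] lemma propagator_zero (A : Matrix n n ℂ) : propagator A 0 = 1 := by
  simp [propagator]

lemma conjTranspose_propagator {A : Matrix n n ℂ} (hA : A.IsHermitian) (t : ℝ) :
    (propagator A t)ᴴ = NormedSpace.exp (-(Complex.I * t) • A) := by
  rw [propagator, ← Matrix.exp_conjTranspose, Matrix.conjTranspose_smul, hA.eq]
  simp

lemma propagator_mem_unitaryGroup {A : Matrix n n ℂ} (hA : A.IsHermitian) (t : ℝ) :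
    propagator A t ∈ Matrix.unitaryGroup n ℂ := by
  have h : (t • A).IsHermitian := by
    rw [Matrix.IsHermitian, Matrix.conjTranspose_smul, hA.eq]; simp
  have := (selfAdjoint.expUnitary (A := Matrix n n ℂ) ⟨t • A, h⟩).2
  rwa [selfAdjoint.expUnitary_coe, smul_comm, ← propagator_eq_exp_smul] at this

lemma norm_le_one_of_mem_unitaryGroup {U : Matrix n n ℂ} (hU : U ∈ Matrix.unitaryGroup n ℂ) :
    ‖U‖ ≤ 1 := by
  rcases subsingleton_or_nontrivial (Matrix n n ℂ) with h | h
  · rw [Subsingleton.elim U 0, norm_zero]; exact zero_le_one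
  · exact (CStarRing.norm_of_mem_unitary hU).le

lemma norm_propagator_le_one {A : Matrix n n ℂ} (hA : A.IsHermitian) (t : ℝ) :
    ‖propagator A t‖ ≤ 1 :=
  norm_le_one_of_mem_unitaryGroup (propagator_mem_unitaryGroup hA t)

lemma hasDerivAt_propagator (A : Matrix n n ℂ) (t : ℝ) :
    HasDerivAt (propagator A) ((Complex.I • A) * propagator A t) t := by
  have h := hasDerivAt_exp_smul_const' (𝕂 := ℝ) (Complex.I • A) t
  rw [← propagator_eq_exp_smul] at h
  exact h.congr_of_eventuallyEq (Eventually.of_forall fun s => propagator_eq_exp_smul A s)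

lemma hasDerivAt_propagator' (A : Matrix n n ℂ) (t : ℝ) :
    HasDerivAt (propagator A) (propagator A t * (Complex.I • A)) t := by
  have h := hasDerivAt_exp_smul_const (𝕂 := ℝ) (Complex.I • A) t
  rw [← propagator_eq_exp_smul] at h
  exact h.congr_of_eventuallyEq (Eventually.of_forall fun s => propagator_eq_exp_smul A s)

lemma propagator_neg_mul_self (A : Matrix n n ℂ) (t : ℝ) :
    propagator (-A) t * propagator A t = 1 := by
  rw [propagator, propagator, smul_neg,
    ← Matrix.exp_add_of_commute _ _ (Commute.refl ((Complex.I * (t : ℂ)) • A)).neg_left]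
  simp

lemma propagator_self_mul_neg (A : Matrix n n ℂ) (t : ℝ) :
    propagator A t * propagator (-A) t = 1 := by
  simpa using propagator_neg_mul_self (-A) t

/-- The two contributions of `H` cancel in the product rule, so only the perturbation drives the
motion. This supplies one factor `V` per order of the expansion. -/
lemma hasDerivAt_interactionPicture (H V : Matrix n n ℂ) (t : ℝ) :
    HasDerivAt (fun s => propagator (-H) s * propagator (H + V) s)
      (propagator (-H) t * (Complex.I • V) * propagator (H + V) t) t := by
  have h := (hasDerivAt_propagator' (-H) t).mul (hasDerivAt_propagator (H + V) t)
  refine h.congr_deriv ?_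
  simp only [smul_add, smul_neg, mul_neg, neg_mul, add_mul, mul_add, mul_assoc]
  abel

lemma norm_interactionPicture_deriv_le {A B : Matrix n n ℂ} (V : Matrix n n ℂ) (hA : ‖A‖ ≤ 1) :
    ‖A * (Complex.I • V) * B‖ ≤ ‖V‖ * ‖B‖ := by
  have hI : ‖Complex.I • V‖ = ‖V‖ := by rw [norm_smul]; simp
  calc _ ≤ ‖A‖ * ‖Complex.I • V‖ * ‖B‖ :=
        (norm_mul_le _ _).trans (mul_le_mul_of_nonneg_right (norm_mul_le _ _) (norm_nonneg _))
    _ ≤ 1 * ‖V‖ * ‖B‖ := by rw [hI]; gcongr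
    _ = _ := by ring

/-- Switching on `V` changes the evolution by at most `t ‖V‖`. -/
lemma norm_propagator_add_sub_le {H V : Matrix n n ℂ} (hH : H.IsHermitian) (hV : V.IsHermitian)
    {t : ℝ} (ht : 0 ≤ t) : ‖propagator (H + V) t - propagator H t‖ ≤ ‖V‖ * t := by
  have hf := (convex_Icc (0 : ℝ) t).norm_image_sub_le_of_norm_hasDerivWithin_le (C := ‖V‖)
    (fun s _ => (hasDerivAt_interactionPicture H V s).hasDerivWithinAt) (fun s _ => by
      refine (norm_interactionPicture_deriv_le V (norm_propagator_le_one hH.neg s)).trans ?_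
      exact mul_le_of_le_one_right (norm_nonneg _) (norm_propagator_le_one (hH.add hV) s))
    (Set.left_mem_Icc.2 ht) (Set.right_mem_Icc.2 ht)
  have e : propagator (H + V) t - propagator H t
      = propagator H t * (propagator (-H) t * propagator (H + V) t
        - propagator (-H) 0 * propagator (H + V) 0) := by
    rw [mul_sub, ← mul_assoc, propagator_self_mul_neg]; simp
  rw [e]
  refine (norm_mul_le _ _).trans ((mul_le_of_le_one_left (norm_nonneg _)
    (norm_propagator_le_one hH t)).trans ?_)
  simpa [abs_of_nonneg ht] using hf

lemma norm_entry_le_l2_opNorm (A : Matrix n n ℂ) (i j : n) : ‖A i j‖ ≤ ‖A‖ := by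
  have h := Matrix.l2_opNorm_mulVec A (EuclideanSpace.single j (1 : ℂ))
  rw [PiLp.norm_single, norm_one, mul_one] at h
  refine le_trans ?_ h
  have := PiLp.norm_apply_le ((EuclideanSpace.equiv n ℂ).symm
    (A *ᵥ (EuclideanSpace.single j (1 : ℂ)).ofLp)) i
  simpa using this

lemma hasDerivAt_entry {F : ℝ → Matrix n n ℂ} {F' : Matrix n n ℂ} {t : ℝ} (h : HasDerivAt F F' t)
    (i j : n) : HasDerivAt (fun s => F s i j) (F' i j) t :=
  ((Matrix.entryLinearMap ℝ ℂ i j).toContinuousLinearMap.hasFDerivAt.comp_hasDerivAt t h)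

/-- The Fourier phase integral `∫₀ᵗ e^{-iωx} dx` of first order perturbation theory. -/
def phaseIntegral (ω t : ℝ) : ℂ := ∫ x in (0 : ℝ)..t, Complex.exp (-Complex.I * ω * x)

lemma hasDerivAt_phaseIntegral (ω t : ℝ) :
    HasDerivAt (phaseIntegral ω) (Complex.exp (-Complex.I * ω * t)) t := by
  have hc : Continuous fun x : ℝ => Complex.exp (-Complex.I * ω * x) := by fun_prop
  exact intervalIntegral.integral_hasDerivAt_right (hc.intervalIntegrable _ _)
    (hc.stronglyMeasurableAtFilter _ _) hc.continuousAt

lemma propagator_diagonal (E : n → ℝ) (t : ℝ) :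
    propagator (Matrix.diagonal fun i => (E i : ℂ)) t
      = Matrix.diagonal fun i => Complex.exp (Complex.I * E i * t) := by
  rw [propagator, ← Matrix.diagonal_smul, Matrix.exp_diagonal]
  congr 1
  ext i
  rw [Pi.coe_exp, ← Complex.exp_eq_exp_ℂ]
  simp only [Pi.smul_apply, smul_eq_mul]
  ring_nf

/-- Second order perturbation theory for a transition amplitude. -/
lemma exists_norm_propagator_add_apply_eq (E : n → ℝ) {V : Matrix n n ℂ} (hV : V.IsHermitian)
    {t : ℝ} (ht : 0 ≤ t) {a b : n} (hab : a ≠ b) :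
    ∃ r : ℂ, ‖r‖ ≤ ‖V‖ ^ 2 * t ^ 2 ∧
      ‖propagator ((Matrix.diagonal fun i => (E i : ℂ)) + V) t a b‖
        = ‖Complex.I * V a b * phaseIntegral (E a - E b) t + r‖ := by
  set H : Matrix n n ℂ := Matrix.diagonal fun i => (E i : ℂ) with hHdef
  have hH : H.IsHermitian := by
    rw [Matrix.IsHermitian, hHdef, Matrix.diagonal_conjTranspose]; congr 1; ext; simp
  have hneg : ∀ s, propagator (-H) s = Matrix.diagonal fun i => Complex.exp (-Complex.I * E i * s) := by
    intro s
    have := propagator_diagonal (fun i => - E i) s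
    rw [show -H = Matrix.diagonal fun i => ((-E i : ℝ) : ℂ) by
      rw [hHdef, Matrix.diagonal_neg]; congr 1; ext; simp, this]
    congr 1; ext; simp
  set F : ℝ → Matrix n n ℂ := fun s => propagator (-H) s * propagator (H + V) s with hF
  -- `g` is the remainder after first order. In its derivative the perturbed propagator appears only
  -- through its difference from the free one, which is itself of order `‖V‖s`; this gives the
  -- second factor `V`.
  set g : ℝ → ℂ := fun s => F s a b - Complex.I * V a b * phaseIntegral (E a - E b) s with hg
  have hder : ∀ s, HasDerivAt g
      ((propagator (-H) s * (Complex.I • V) * (propagator (H + V) s - propagator H s)) a b) s := by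
    intro s
    have h1 := hasDerivAt_entry (hasDerivAt_interactionPicture H V s) a b
    have h2 := (hasDerivAt_phaseIntegral (E a - E b) s).const_mul (Complex.I * V a b)
    refine (h1.sub h2).congr_deriv ?_
    symm
    rw [mul_sub, Matrix.sub_apply]
    congr 1
    rw [hneg, hHdef, propagator_diagonal, Matrix.mul_diagonal, Matrix.diagonal_mul]
    simp only [Matrix.smul_apply, smul_eq_mul]
    rw [show -Complex.I * ((E a - E b : ℝ) : ℂ) * s
        = -Complex.I * E a * s + Complex.I * E b * s by push_cast; ring, Complex.exp_add]
    ring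
  have hbound := (convex_Icc (0 : ℝ) t).norm_image_sub_le_of_norm_hasDerivWithin_le
    (C := ‖V‖ ^ 2 * t) (f := g) (fun s _ => (hder s).hasDerivWithinAt) (fun s hs => by
      refine (norm_entry_le_l2_opNorm _ _ _).trans
        ((norm_interactionPicture_deriv_le V (norm_propagator_le_one hH.neg s)).trans ?_)
      rw [pow_two, mul_assoc]
      refine mul_le_mul_of_nonneg_left ?_ (norm_nonneg _)
      exact (norm_propagator_add_sub_le hH hV hs.1).trans
        (mul_le_mul_of_nonneg_left hs.2 (norm_nonneg _)))
    (Set.left_mem_Icc.2 ht) (Set.right_mem_Icc.2 ht)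
  have hg0 : g 0 = 0 := by simp [hg, hF, phaseIntegral, hab]
  refine ⟨g t, ?_, ?_⟩
  · rw [hg0, sub_zero, sub_zero, Real.norm_of_nonneg ht] at hbound
    exact hbound.trans_eq (by ring)
  · rw [show Complex.I * V a b * phaseIntegral (E a - E b) t + g t = F t a b by simp [hg]]
    simp only [hF]
    -- Passing to the interaction picture multiplies each entry by a phase of modulus one.
    rw [hneg, Matrix.diagonal_mul, norm_mul, Complex.norm_exp]
    simp

lemma norm_phaseIntegral_le (ω : ℝ) {t : ℝ} (ht : 0 ≤ t) : ‖phaseIntegral ω t‖ ≤ t := by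
  have := intervalIntegral.norm_integral_le_of_norm_le_const (a := 0) (b := t) (C := 1)
    (f := fun x : ℝ => Complex.exp (-Complex.I * ω * x)) (fun x _ => by
      rw [Complex.norm_exp]; simp)
  simpa [phaseIntegral, abs_of_nonneg ht] using this

lemma norm_phaseIntegral_le_two_div {ω : ℝ} (hω : ω ≠ 0) (t : ℝ) :
    ‖phaseIntegral ω t‖ ≤ 2 / |ω| := by
  have hc : -Complex.I * (ω : ℂ) ≠ 0 := by simp [hω]
  rw [phaseIntegral, integral_exp_mul_complex hc, norm_div]
  have h1 : ‖-Complex.I * (ω : ℂ)‖ = |ω| := by simp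
  rw [h1]
  gcongr
  refine (norm_sub_le _ _).trans ?_
  rw [Complex.norm_exp, Complex.norm_exp]
  simp; norm_num

/-- Near resonance the phases barely rotate: by `cos y ≥ 1 - y²/2` the real part is at least `t(1 -
ω²t²/6)`. -/
lemma le_norm_phaseIntegral {ω t : ℝ} (ht : 0 ≤ t) (h : (ω * t) ^ 2 ≤ 2) :
    2 / 3 * t ≤ ‖phaseIntegral ω t‖ := by
  have hc : Continuous fun x : ℝ => Complex.exp (-Complex.I * ω * x) := by fun_prop
  have hre : (phaseIntegral ω t).re = ∫ x in (0 : ℝ)..t, Real.cos (ω * x) := by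
    have := Complex.reCLM.intervalIntegral_comp_comm (hc.intervalIntegrable (μ := volume) 0 t)
    rw [phaseIntegral]
    refine this.symm.trans (intervalIntegral.integral_congr fun x _ => ?_)
    simp [Complex.exp_re]
  have hlow : ∫ x in (0 : ℝ)..t, (1 - ω ^ 2 / 2 * x ^ 2) ≤ ∫ x in (0 : ℝ)..t, Real.cos (ω * x) := by
    refine intervalIntegral.integral_mono_on ht ?_ ?_ fun x _ => ?_
    · exact Continuous.intervalIntegrable (by fun_prop) _ _
    · exact Continuous.intervalIntegrable (by fun_prop) _ _
    · have := Real.one_sub_sq_div_two_le_cos (x := ω * x)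
      nlinarith
  have hval : ∫ x in (0 : ℝ)..t, (1 - ω ^ 2 / 2 * x ^ 2) = t - ω ^ 2 * t ^ 3 / 6 := by
    rw [intervalIntegral.integral_sub (by simp) (Continuous.intervalIntegrable (by fun_prop) _ _),
      intervalIntegral.integral_const_mul, integral_pow]
    simp; ring
  have : 2 / 3 * t ≤ t - ω ^ 2 * t ^ 3 / 6 := by nlinarith
  calc _ ≤ (phaseIntegral ω t).re := by rw [hre]; linarith
    _ ≤ _ := Complex.re_le_norm _

end Propagator

end Thermalization

end

noncomputable section

namespace Thermalization

/-! ### Moments of Haar random unitaries and of the random interaction -/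

section Haar

variable {n : Type*} [Fintype n] [DecidableEq n]

instance isProbabilityMeasure_haarUnitary : IsProbabilityMeasure (haarUnitary n) :=
  ⟨Measure.haarMeasure_self⟩

instance isMulLeftInvariant_haarUnitary : (haarUnitary n).IsMulLeftInvariant :=
  inferInstanceAs (Measure.haarMeasure _).IsMulLeftInvariant

instance secondCountableTopology_unitaryGroup :
    SecondCountableTopology (Matrix.unitaryGroup n ℂ) :=
  haveI : SecondCountableTopology (Matrix n n ℂ) :=
    inferInstanceAs (SecondCountableTopology (n → n → ℂ))
  TopologicalSpace.Subtype.secondCountableTopology _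

instance isProbabilityMeasure_interactionLaw : IsProbabilityMeasure (interactionLaw n) :=
  inferInstanceAs (IsProbabilityMeasure (Measure.prod _ _))

lemma integrable_haarUnitary {E : Type*} [NormedAddCommGroup E]
    {f : Matrix.unitaryGroup n ℂ → E} (hf : Continuous f) : Integrable f (haarUnitary n) :=
  haveI : IsFiniteMeasureOnCompacts (haarUnitary n) := inferInstance
  hf.integrable_of_hasCompactSupport (HasCompactSupport.of_compactSpace f)

@[fun_prop]
lemma continuous_unitaryGroup_apply (a b : n) :
    Continuous fun U : Matrix.unitaryGroup n ℂ => (U : Matrix n n ℂ) a b :=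
  continuous_subtype_val.matrix_elem a b

lemma sum_normSq_row {U : Matrix n n ℂ} (hU : U ∈ Matrix.unitaryGroup n ℂ) (a : n) :
    ∑ k, ‖U a k‖ ^ 2 = 1 := by
  have h := congrFun (congrFun (Matrix.mem_unitaryGroup_iff.1 hU) a) a
  rw [Matrix.mul_apply, Matrix.one_apply_eq] at h
  have : ((∑ k, ‖U a k‖ ^ 2 : ℝ) : ℂ) = 1 := by
    rw [← h]
    push_cast
    refine Finset.sum_congr rfl fun k _ => ?_
    rw [Matrix.star_apply, RCLike.star_def, Complex.mul_conj']
  exact_mod_cast this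

lemma sum_normSq_col {U : Matrix n n ℂ} (hU : U ∈ Matrix.unitaryGroup n ℂ) (k : n) :
    ∑ a, ‖U a k‖ ^ 2 = 1 := by
  have h := sum_normSq_row (Unitary.star_mem hU) k
  simpa [Matrix.star_apply] using h

/-- The permutation matrix of the transposition of `a` and `b`. -/
def swapMatrix (a b : n) : Matrix n n ℂ := (1 : Matrix n n ℂ).submatrix (Equiv.swap a b) id

lemma swapMatrix_mul (a b : n) (M : Matrix n n ℂ) :
    swapMatrix a b * M = M.submatrix (Equiv.swap a b) id := by
  ext i j
  simp [swapMatrix, Matrix.mul_apply, Matrix.one_apply]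

lemma star_swapMatrix {n : Type*} [DecidableEq n] (a b : n) : star (swapMatrix a b) = swapMatrix a b := by
  ext i j
  have : Equiv.swap a b j = i ↔ Equiv.swap a b i = j := by
    rw [Equiv.swap_apply_eq_iff]; exact eq_comm
  simp [swapMatrix, Matrix.star_apply, Matrix.one_apply, this, apply_ite]

lemma swapMatrix_mul_self (a b : n) : swapMatrix a b * swapMatrix a b = 1 := by
  rw [swapMatrix_mul]
  ext i j
  simp [swapMatrix, Matrix.one_apply]

lemma swapMatrix_mem_unitaryGroup (a b : n) : swapMatrix a b ∈ Matrix.unitaryGroup n ℂ := by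
  rw [Matrix.mem_unitaryGroup_iff, star_swapMatrix, swapMatrix_mul_self]

/-- The rotation `(1 + iS)/√2`, with `S` the transposition of `a` and `b`. -/
def halfSwap (a b : n) : Matrix n n ℂ := ((√2)⁻¹ : ℂ) • (1 + Complex.I • swapMatrix a b)

lemma halfSwap_mem_unitaryGroup (a b : n) : halfSwap a b ∈ Matrix.unitaryGroup n ℂ := by
  have h2 : ((√2 : ℂ))⁻¹ * ((√2 : ℂ))⁻¹ * 2 = 1 := by
    have : ((√2 : ℝ) : ℂ) * ((√2 : ℝ) : ℂ) = 2 := by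
      rw [← Complex.ofReal_mul]; norm_num
    rw [← mul_inv, this]; norm_num
  rw [Matrix.mem_unitaryGroup_iff, halfSwap, star_smul, star_add, star_smul, star_swapMatrix,
    star_one, smul_mul_smul_comm]
  have : (1 + Complex.I • swapMatrix a b) * (1 + star Complex.I • swapMatrix a b)
      = (2 : ℂ) • 1 := by
    simp only [add_mul, mul_add, one_mul, mul_one, smul_mul_assoc, mul_smul_comm,
      swapMatrix_mul_self, RCLike.star_def, Complex.conj_I, neg_smul, mul_neg, smul_add, smul_smul,
      Complex.I_mul_I, one_smul, two_smul]
    abel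
  rw [this, smul_smul]
  simp [h2]

lemma halfSwap_mul_apply_left (a b : n) (M : Matrix n n ℂ) (k : n) :
    (halfSwap a b * M) a k = ((√2)⁻¹ : ℂ) * (M a k + Complex.I * M b k) := by
  simp [halfSwap, add_mul, mul_add, swapMatrix_mul]

lemma halfSwap_mul_apply_right (a b : n) (M : Matrix n n ℂ) (k : n) :
    (halfSwap a b * M) b k = ((√2)⁻¹ : ℂ) * (M b k + Complex.I * M a k) := by
  simp [halfSwap, add_mul, mul_add, swapMatrix_mul]

/-- The diagonal unitary with a phase `v i` in position `i`. -/
lemma diagonal_mem_unitaryGroup {v : n → ℂ} (hv : ∀ i, ‖v i‖ = 1) :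
    Matrix.diagonal v ∈ Matrix.unitaryGroup n ℂ := by
  rw [Matrix.mem_unitaryGroup_iff, Matrix.star_eq_conjTranspose, Matrix.diagonal_conjTranspose,
    Matrix.diagonal_mul_diagonal, ← Matrix.diagonal_one]
  congr 1
  ext i
  simp [Complex.mul_conj', hv]

/-- Up to phases and the factor `1/√2`, the four numbers are `u + iv`, `v + iu`, `u - v` and `u +
v`. Terms linear in the cross term cancel in pairs, and the squares of the real and imaginary parts
of `u v̄` add up to `|u|²|v|²`. -/
lemma normSq_rotation_identity (u v : ℂ) :
    (‖((√2)⁻¹ : ℂ) * (u + Complex.I * v)‖ ^ 4 + ‖((√2)⁻¹ : ℂ) * (v + Complex.I * u)‖ ^ 4)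
      + (‖((√2)⁻¹ : ℂ) * (u + Complex.I * (Complex.I * v))‖ ^ 4
        + ‖((√2)⁻¹ : ℂ) * (Complex.I * v + Complex.I * u)‖ ^ 4)
      = ‖u‖ ^ 4 + ‖v‖ ^ 4 + 4 * (‖u‖ ^ 2 * ‖v‖ ^ 2) := by
  have h4 : ∀ z : ℂ, ‖z‖ ^ 4 = (z.re ^ 2 + z.im ^ 2) ^ 2 := fun z => by
    rw [show (4 : ℕ) = 2 * 2 from rfl, pow_mul, Complex.sq_norm, Complex.normSq_apply]; ring
  have h2 : ∀ z : ℂ, ‖z‖ ^ 2 = z.re ^ 2 + z.im ^ 2 := fun z => by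
    rw [Complex.sq_norm, Complex.normSq_apply]; ring
  have hs : ‖((√2)⁻¹ : ℂ)‖ ^ 4 = 1 / 4 := by
    rw [norm_inv, Complex.norm_real, Real.norm_of_nonneg (Real.sqrt_nonneg 2), inv_pow,
      show (4 : ℕ) = 2 * 2 from rfl, pow_mul, Real.sq_sqrt (by norm_num)]
    norm_num
  simp only [norm_mul _ (_ + _), mul_pow, hs]
  simp only [h4, h2, Complex.add_re, Complex.add_im, Complex.mul_re, Complex.mul_im,
    Complex.I_re, Complex.I_im]
  ring

lemma integral_haarUnitary_mul_left {E : Type*} [NormedAddCommGroup E] [NormedSpace ℝ E]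
    {W : Matrix n n ℂ} (hW : W ∈ Matrix.unitaryGroup n ℂ) (f : Matrix n n ℂ → E) :
    ∫ U, f (W * (U : Matrix n n ℂ)) ∂haarUnitary n = ∫ U, f (U : Matrix n n ℂ) ∂haarUnitary n :=
  integral_mul_left_eq_self (μ := haarUnitary n) (fun U => f (U : Matrix n n ℂ))
    (⟨W, hW⟩ : Matrix.unitaryGroup n ℂ)

lemma integral_haarUnitary_row_eq {E : Type*} [NormedAddCommGroup E] [NormedSpace ℝ E]
    (f : ℂ → E) (a b k : n) :
    ∫ U, f ((U : Matrix n n ℂ) a k) ∂haarUnitary n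
      = ∫ U, f ((U : Matrix n n ℂ) b k) ∂haarUnitary n := by
  have h := integral_haarUnitary_mul_left (swapMatrix_mem_unitaryGroup a b) (fun M => f (M b k))
  simpa [swapMatrix_mul] using h

lemma integral_haarUnitary_normSq (a k : n) :
    ∫ U, ‖(U : Matrix n n ℂ) a k‖ ^ 2 ∂haarUnitary n = 1 / Fintype.card n := by
  have hne : Nonempty n := ⟨a⟩
  have hsum : ∑ b, ∫ U, ‖(U : Matrix n n ℂ) b k‖ ^ 2 ∂haarUnitary n = 1 := by
    rw [← integral_finsetSum _ fun b _ => integrable_haarUnitary (by fun_prop)]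
    rw [integral_congr_ae (Eventually.of_forall fun U : Matrix.unitaryGroup n ℂ =>
      sum_normSq_col U.2 k)]
    simp
  rw [Finset.sum_congr rfl fun b _ => integral_haarUnitary_row_eq (fun z => ‖z‖ ^ 2) b a k] at hsum
  rw [Finset.sum_const, Finset.card_univ, nsmul_eq_mul] at hsum
  rw [eq_div_iff (by exact_mod_cast Fintype.card_ne_zero), mul_comm, hsum]

/-- Weingarten calculus in degree two: `2 E|U_{ak}|²|U_{bk}|² = E|U_{ak}|⁴`. -/
lemma integral_haarUnitary_normSq_mul_normSq {a b : n} (hab : a ≠ b) (k : n) :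
    2 * ∫ U, ‖(U : Matrix n n ℂ) a k‖ ^ 2 * ‖(U : Matrix n n ℂ) b k‖ ^ 2 ∂haarUnitary n
      = ∫ U, ‖(U : Matrix n n ℂ) a k‖ ^ 4 ∂haarUnitary n := by
  set f : Matrix n n ℂ → ℝ := fun M => ‖M a k‖ ^ 4 + ‖M b k‖ ^ 4 with hf
  -- The rotation alone sees only one of the real and imaginary parts of the cross term. The extra
  -- phase `i` on row `b` brings in the other. By left invariance both rotated averages of `f` equal
  -- `E f`, so `2 E f = E f + 4 E|U_{ak}|²|U_{bk}|²`.
  set D : Matrix n n ℂ := Matrix.diagonal fun i => if i = b then Complex.I else 1 with hD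
  have hDmem : D ∈ Matrix.unitaryGroup n ℂ :=
    diagonal_mem_unitaryGroup fun i => by split_ifs <;> simp
  have hW := halfSwap_mem_unitaryGroup a b
  have h1 := integral_haarUnitary_mul_left hW f
  have h2 := integral_haarUnitary_mul_left (mul_mem hW hDmem) f
  have hcont : Continuous fun U : Matrix.unitaryGroup n ℂ => f U := by fun_prop
  have hc : ∀ {W : Matrix n n ℂ} (hW : W ∈ Matrix.unitaryGroup n ℂ),
      Integrable (fun U : Matrix.unitaryGroup n ℂ => f (W * U)) (haarUnitary n) := fun {W} hW =>
    integrable_haarUnitary (hcont.comp (continuous_const_mul (⟨W, hW⟩ : Matrix.unitaryGroup n ℂ)))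
  have key : ∀ U : Matrix.unitaryGroup n ℂ, f (halfSwap a b * U) + f (halfSwap a b * D * U)
      = f U + 4 * (‖(U : Matrix n n ℂ) a k‖ ^ 2 * ‖(U : Matrix n n ℂ) b k‖ ^ 2) := by
    intro U
    simp only [hf, mul_assoc, halfSwap_mul_apply_left, halfSwap_mul_apply_right]
    simp only [hD, Matrix.diagonal_mul, if_true, if_neg hab, one_mul]
    exact normSq_rotation_identity _ _
  have h3 := integral_congr_ae (μ := haarUnitary n) (Eventually.of_forall key)
  rw [integral_add (hc hW) (hc (mul_mem hW hDmem)), h1, h2,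
    integral_add (integrable_haarUnitary hcont) (integrable_haarUnitary (by fun_prop)),
    integral_const_mul] at h3
  have hfint : ∫ U, f U ∂haarUnitary n = 2 * ∫ U, ‖(U : Matrix n n ℂ) a k‖ ^ 4 ∂haarUnitary n := by
    simp only [hf]
    rw [integral_add (integrable_haarUnitary (by fun_prop)) (integrable_haarUnitary (by fun_prop)),
      integral_haarUnitary_row_eq (fun z => ‖z‖ ^ 4) b a k]
    ring
  linarith

/-- Normalization of column `k` fixes the one remaining unknown `y = E|U_{ak}|⁴`: with `N` the
dimension, the `N - 1` mixed moments `y/2` and the diagonal term `y` add up to `E|U_{ak}|² = 1/N`.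
-/
lemma integral_haarUnitary_normSq_mul_normSq_eq {a b : n} (hab : a ≠ b) (k : n) :
    ∫ U, ‖(U : Matrix n n ℂ) a k‖ ^ 2 * ‖(U : Matrix n n ℂ) b k‖ ^ 2 ∂haarUnitary n
      = 1 / (Fintype.card n * (Fintype.card n + 1)) := by
  set y := ∫ U, ‖(U : Matrix n n ℂ) a k‖ ^ 4 ∂haarUnitary n with hy
  have hsum : ∑ c, ∫ U, ‖(U : Matrix n n ℂ) a k‖ ^ 2 * ‖(U : Matrix n n ℂ) c k‖ ^ 2 ∂haarUnitary n
      = 1 / Fintype.card n := by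
    rw [← integral_finsetSum _ fun b _ => integrable_haarUnitary (by fun_prop),
      ← integral_haarUnitary_normSq a k]
    refine integral_congr_ae (Eventually.of_forall fun U => ?_)
    simp only [← Finset.mul_sum, sum_normSq_col U.2 k, mul_one]
  have hterm : ∀ c, ∫ U, ‖(U : Matrix n n ℂ) a k‖ ^ 2 * ‖(U : Matrix n n ℂ) c k‖ ^ 2 ∂haarUnitary n
      = y / 2 + if c = a then y / 2 else 0 := by
    intro c
    split_ifs with h
    · subst h
      rw [add_halves, hy]
      exact integral_congr_ae (Eventually.of_forall fun U => by ring)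
    · linarith [integral_haarUnitary_normSq_mul_normSq (Ne.symm h) k]
  have hb := hterm b
  rw [if_neg hab.symm, add_zero] at hb
  rw [Finset.sum_congr rfl fun c _ => hterm c, Finset.sum_add_distrib] at hsum
  simp only [Finset.sum_const, Finset.card_univ, nsmul_eq_mul, Finset.sum_ite_eq',
    Finset.mem_univ, if_true] at hsum
  have hn : (0 : ℝ) < Fintype.card n := by exact_mod_cast Fintype.card_pos_iff.2 ⟨a⟩
  rw [hb, eq_div_iff (by positivity)]
  field_simp at hsum ⊢
  linarith

end Haar

end Thermalization

end

noncomputable section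

namespace Thermalization

/-! ### Norm bound and second moments of the random interaction -/

section Interaction

open scoped Matrix.Norms.L2Operator

variable {n : Type*} [Fintype n] [DecidableEq n]

lemma isHermitian_interaction (p : Matrix.unitaryGroup n ℂ × (n → ℝ)) :
    (interaction p).IsHermitian := by
  have h : (Matrix.diagonal fun i => (p.2 i : ℂ)).IsHermitian := by
    rw [Matrix.IsHermitian, Matrix.diagonal_conjTranspose]; congr 1; ext; simp
  exact Matrix.isHermitian_mul_mul_conjTranspose _ h

lemma continuous_interaction : Continuous (interaction (n := n)) := by
  have h1 : Continuous fun p : Matrix.unitaryGroup n ℂ × (n → ℝ) => (p.1 : Matrix n n ℂ) :=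
    continuous_subtype_val.comp continuous_fst
  have h2 : Continuous fun p : Matrix.unitaryGroup n ℂ × (n → ℝ) =>
      Matrix.diagonal fun i => (p.2 i : ℂ) := Continuous.matrix_diagonal (by fun_prop)
  exact (h1.mul h2).mul h1.matrix_conjTranspose

lemma interaction_apply (p : Matrix.unitaryGroup n ℂ × (n → ℝ)) (a b : n) :
    interaction p a b = ∑ k, ((p.1 : Matrix n n ℂ) a k * star ((p.1 : Matrix n n ℂ) b k)) * p.2 k := by
  rw [interaction, Matrix.mul_apply]
  refine Finset.sum_congr rfl fun k _ => ?_
  rw [Matrix.mul_diagonal, Matrix.conjTranspose_apply]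
  ring

/-- The norm of `UDU†` is at most the largest `|dᵢ|`. The cruder sum of squares is a polynomial in
the Gaussians alone, so remainders can be integrated without reference to `U`. -/
lemma norm_interaction_sq_le (p : Matrix.unitaryGroup n ℂ × (n → ℝ)) :
    ‖interaction p‖ ^ 2 ≤ ∑ i, p.2 i ^ 2 := by
  have hU := norm_le_one_of_mem_unitaryGroup p.1.2
  have hd : ‖Matrix.diagonal fun i => (p.2 i : ℂ)‖ ≤ √(∑ i, p.2 i ^ 2) := by
    rw [Matrix.l2_opNorm_diagonal]
    refine (pi_norm_le_iff_of_nonneg (Real.sqrt_nonneg _)).2 fun i => ?_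
    rw [Complex.norm_real, Real.norm_eq_abs]
    refine Real.abs_le_sqrt (Finset.single_le_sum (f := fun i => p.2 i ^ 2)
      (fun i _ => sq_nonneg _) (Finset.mem_univ i))
  have h : ‖interaction p‖ ≤ √(∑ i, p.2 i ^ 2) := by
    rw [interaction]
    refine (norm_mul_le _ _).trans ?_
    rw [Matrix.l2_opNorm_conjTranspose]
    refine (mul_le_of_le_one_right (norm_nonneg _) hU).trans ((norm_mul_le _ _).trans ?_)
    exact (mul_le_of_le_one_left (norm_nonneg _) hU).trans hd
  calc _ ≤ √(∑ i, p.2 i ^ 2) ^ 2 := by gcongr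
    _ = _ := Real.sq_sqrt (Finset.sum_nonneg fun i _ => sq_nonneg _)

/-- The law of i.i.d. standard normal eigenvalues. -/
abbrev normalLaw (n : Type*) [Fintype n] : Measure (n → ℝ) := Measure.pi fun _ => gaussianReal 0 1

lemma memLp_normalLaw_eval {n : Type*} [Fintype n] (k : n) (q : NNReal) :
    MemLp (fun d : n → ℝ => d k) q (normalLaw n) :=
  (memLp_id_gaussianReal q).comp_measurePreserving
    (measurePreserving_eval (fun _ : n => gaussianReal 0 1) k)

lemma memLp_two_normalLaw_eval {n : Type*} [Fintype n] (k : n) :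
    MemLp (fun d : n → ℝ => d k) 2 (normalLaw n) := by
  simpa using memLp_normalLaw_eval k 2

lemma integrable_normalLaw_mul {n : Type*} [Fintype n] (k l : n) :
    Integrable (fun d : n → ℝ => d k * d l) (normalLaw n) :=
  (memLp_two_normalLaw_eval k).integrable_mul (memLp_two_normalLaw_eval l)

lemma integral_normalLaw_mul (k l : n) :
    ∫ d, d k * d l ∂normalLaw n = if k = l then 1 else 0 := by
  have hmean : ∀ k, ∫ d, d k ∂normalLaw n = 0 := fun k => by
    rw [integral_comp_eval (μ := fun _ : n => gaussianReal 0 1) (f := fun x : ℝ => x) (by fun_prop)]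
    exact integral_id_gaussianReal
  split_ifs with h
  · subst h
    rw [integral_comp_eval (μ := fun _ : n => gaussianReal 0 1) (f := fun x : ℝ => x * x)
      (by fun_prop)]
    have hv := variance_id_gaussianReal (μ := 0) (v := 1)
    rw [variance_of_integral_eq_zero aemeasurable_id integral_id_gaussianReal] at hv
    simpa [pow_two] using hv
  · have hind := (iIndepFun_pi (μ := fun _ : n => gaussianReal 0 1) (X := fun _ x => x)
      fun _ => aemeasurable_id).indepFun h
    have := hind.integral_mul_eq_mul_integral (memLp_normalLaw_eval k 1).1 (memLp_normalLaw_eval l 1).1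
    refine this.trans ?_
    rw [hmean, zero_mul]

lemma integral_normalLaw_normSq_sum (c : n → ℂ) :
    ∫ d, ‖∑ k, c k * (d k : ℂ)‖ ^ 2 ∂normalLaw n = ∑ k, ‖c k‖ ^ 2 := by
  have h : ∀ d : n → ℝ, ‖∑ k, c k * (d k : ℂ)‖ ^ 2
      = ∑ k, ∑ l, (c k * star (c l)).re * (d k * d l) := by
    intro d
    have h1 : ‖∑ k, c k * (d k : ℂ)‖ ^ 2
        = ((∑ k, c k * (d k : ℂ)) * star (∑ k, c k * (d k : ℂ))).re := by
      rw [RCLike.star_def, Complex.mul_conj', ← Complex.ofReal_pow, Complex.ofReal_re]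
    rw [h1, star_sum, Finset.sum_mul_sum, Complex.re_sum]
    refine Finset.sum_congr rfl fun k _ => ?_
    rw [Complex.re_sum]
    refine Finset.sum_congr rfl fun l _ => ?_
    rw [star_mul', RCLike.star_def, Complex.conj_ofReal,
      show c k * d k * ((starRingEnd ℂ) (c l) * d l)
        = c k * (starRingEnd ℂ) (c l) * ((d k * d l : ℝ) : ℂ) by push_cast; ring,
      Complex.re_mul_ofReal]
  simp only [h]
  rw [integral_finsetSum _ fun k _ => integrable_finsetSum _ fun l _ =>
    (integrable_normalLaw_mul k l).const_mul _]
  refine Finset.sum_congr rfl fun k _ => ?_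
  rw [integral_finsetSum _ fun l _ => (integrable_normalLaw_mul k l).const_mul _]
  simp only [integral_const_mul, integral_normalLaw_mul, mul_ite, mul_one, mul_zero,
    Finset.sum_ite_eq, Finset.mem_univ, if_true]
  rw [RCLike.star_def, Complex.mul_conj', ← Complex.ofReal_pow, Complex.ofReal_re]

lemma integrable_normalLaw_sum_sq_sq {n : Type*} [Fintype n] :
    Integrable (fun d : n → ℝ => (∑ i, d i ^ 2) ^ 2) (normalLaw n) := by
  refine MemLp.integrable_sq (memLp_finsetSum _ fun i _ => ?_)
  rw [memLp_two_iff_integrable_sq ((measurable_pi_apply i).pow_const 2).aestronglyMeasurable]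
  have := (memLp_normalLaw_eval i 4).integrable_norm_pow (p := 4) (by norm_num)
  refine this.congr (Eventually.of_forall fun d => ?_)
  simp only [Real.norm_eq_abs]
  rw [← pow_mul, Even.pow_abs (by decide)]

lemma integrable_interactionLaw_of_normalLaw {f : (n → ℝ) → ℝ} (hf : Integrable f (normalLaw n)) :
    Integrable (fun p => f p.2) (interactionLaw n) :=
  hf.comp_snd _

lemma integral_interactionLaw_of_normalLaw (f : (n → ℝ) → ℝ) :
    ∫ p, f p.2 ∂interactionLaw n = ∫ d, f d ∂normalLaw n := by
  rw [interactionLaw, integral_fun_snd]; simp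

lemma integrable_normSq_interaction (a b : n) :
    Integrable (fun p => ‖interaction p a b‖ ^ 2) (interactionLaw n) := by
  have hi : Integrable (fun d : n → ℝ => ∑ i, d i ^ 2) (normalLaw n) :=
    integrable_finsetSum _ fun i _ => (memLp_two_normalLaw_eval i).integrable_sq
  refine (integrable_interactionLaw_of_normalLaw hi).mono'
    ((continuous_interaction.matrix_elem a b).norm.pow 2).aestronglyMeasurable
    (Eventually.of_forall fun p => ?_)
  rw [Real.norm_of_nonneg (by positivity)]
  refine le_trans ?_ (norm_interaction_sq_le p)
  gcongr
  exact norm_entry_le_l2_opNorm _ _ _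

/-- Averaging first over the Gaussians, which are orthonormal in `L²`, leaves `∑ₖ
E|U_{ak}|²|U_{bk}|²`, that is `N` terms equal to `1/(N(N+1))`. -/
lemma integral_normSq_interaction {a b : n} (hab : a ≠ b) :
    ∫ p, ‖interaction p a b‖ ^ 2 ∂interactionLaw n = 1 / (Fintype.card n + 1) := by
  have hn : (0 : ℝ) < Fintype.card n := by exact_mod_cast Fintype.card_pos_iff.2 ⟨a⟩
  rw [interactionLaw, integral_prod _ (integrable_normSq_interaction a b)]
  simp only [interaction_apply, integral_normalLaw_normSq_sum, norm_mul, norm_star, mul_pow]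
  rw [integral_finsetSum _ fun k _ => integrable_haarUnitary (by fun_prop)]
  simp only [integral_haarUnitary_normSq_mul_normSq_eq hab, Finset.sum_const, Finset.card_univ,
    nsmul_eq_mul]
  field_simp

end Interaction

end Thermalization

end

noncomputable section

namespace Thermalization

/-! ### The averaged evolution -/

section Average

open scoped Matrix.Norms.L2Operator

variable {n m : Type*} [Fintype n] [DecidableEq n] [Fintype m] [DecidableEq m]

lemma isHermitian_diagonal_ofReal {n : Type*} [DecidableEq n] (E : n → ℝ) :
    (Matrix.diagonal fun i => (E i : ℂ)).IsHermitian := by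
  rw [Matrix.IsHermitian, Matrix.diagonal_conjTranspose]; congr 1; ext; simp

lemma isHermitian_ofReal_smul {n : Type*} {A : Matrix n n ℂ} (hA : A.IsHermitian) (α : ℝ) :
    ((α : ℂ) • A).IsHermitian := by
  rw [Matrix.IsHermitian, Matrix.conjTranspose_smul, hA.eq]; simp

lemma isHermitian_add_interaction {H : Matrix n n ℂ} (hH : H.IsHermitian) (α : ℝ)
    (p : Matrix.unitaryGroup n ℂ × (n → ℝ)) : (H + (α : ℂ) • interaction p).IsHermitian :=
  hH.add (isHermitian_ofReal_smul (isHermitian_interaction p) α)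

lemma evolve_eq {H G : Matrix n n ℂ} {α : ℝ} (h : (H + (α : ℂ) • G).IsHermitian) (t : ℝ)
    (X : Matrix n n ℂ) :
    evolve H G α t X
      = propagator (H + (α : ℂ) • G) t * X * (propagator (H + (α : ℂ) • G) t)ᴴ := by
  rw [conjTranspose_propagator h]; rfl

lemma propagator_conj {W : Matrix n n ℂ} (hW : W ∈ Matrix.unitaryGroup n ℂ) (A : Matrix n n ℂ)
    (t : ℝ) : propagator (W * A * Wᴴ) t = W * propagator A t * Wᴴ := by
  have hinv : W⁻¹ = Wᴴ := Matrix.inv_eq_right_inv (Matrix.mem_unitaryGroup_iff.1 hW)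
  have hu : IsUnit W := IsUnit.of_mul_eq_one _ (Matrix.mem_unitaryGroup_iff.1 hW)
  rw [propagator, propagator, ← hinv, ← Matrix.exp_conj _ _ hu]
  simp

lemma unitary_conj_mul_conj {W : Matrix n n ℂ} (hW : W ∈ Matrix.unitaryGroup n ℂ)
    (A B : Matrix n n ℂ) : (W * A * Wᴴ) * (W * B * Wᴴ) = W * (A * B) * Wᴴ := by
  have h : Wᴴ * W = 1 := Matrix.mem_unitaryGroup_iff'.1 hW
  calc _ = W * A * (Wᴴ * W) * B * Wᴴ := by simp only [mul_assoc]
    _ = _ := by rw [h]; simp only [mul_assoc, one_mul]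

lemma evolve_conj {H G : Matrix n n ℂ} {α : ℝ} (h : (H + (α : ℂ) • G).IsHermitian) (t : ℝ)
    {W : Matrix n n ℂ} (hW : W ∈ Matrix.unitaryGroup n ℂ) (X : Matrix n n ℂ) :
    evolve (W * H * Wᴴ) (W * G * Wᴴ) α t (W * X * Wᴴ) = W * evolve H G α t X * Wᴴ := by
  have e : W * H * Wᴴ + (α : ℂ) • (W * G * Wᴴ) = W * (H + (α : ℂ) • G) * Wᴴ := by
    simp [mul_add, add_mul]
  rw [evolve_eq h, evolve_eq (e ▸ Matrix.isHermitian_mul_mul_conjTranspose W h), e,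
    propagator_conj hW, Matrix.conjTranspose_mul, Matrix.conjTranspose_mul,
    Matrix.conjTranspose_conjTranspose, ← mul_assoc W, unitary_conj_mul_conj hW,
    unitary_conj_mul_conj hW]

lemma continuous_propagator_interaction (H : Matrix n n ℂ) (α t : ℝ) :
    Continuous fun p => propagator (H + (α : ℂ) • interaction p) t := by
  have : Continuous fun p => (Complex.I * (t : ℂ)) • (H + (α : ℂ) • interaction (n := n) p) :=
    (continuous_const.add (continuous_interaction.fun_const_smul _)).fun_const_smul _
  let _ : NormedAlgebra ℚ (Matrix n n ℂ) := NormedAlgebra.restrictScalars ℚ ℂ _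
  exact NormedSpace.exp_continuous.comp this

lemma integrable_evolve {H : Matrix n n ℂ} (hH : H.IsHermitian) (α t : ℝ) (X : Matrix n n ℂ)
    (a b : n) :
    Integrable (fun p => evolve H (interaction p) α t X a b) (interactionLaw n) := by
  have hA := isHermitian_add_interaction hH α
  simp only [fun p => evolve_eq (hA p) t X]
  have hc := continuous_propagator_interaction H α t
  refine Integrable.of_bound (C := ‖X‖)
    (((hc.mul continuous_const).mul hc.matrix_conjTranspose).matrix_elem a b).aestronglyMeasurable
    (Eventually.of_forall fun p => ?_)
  have hp := norm_propagator_le_one (hA p) t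
  refine (norm_entry_le_l2_opNorm _ _ _).trans ((norm_mul_le _ _).trans ?_)
  rw [Matrix.l2_opNorm_conjTranspose]
  refine (mul_le_of_le_one_right (norm_nonneg _) hp).trans ((norm_mul_le _ _).trans ?_)
  exact mul_le_of_le_one_left (norm_nonneg _) hp

/-- The evolution averaged over the random interaction. -/
def averageEvolve (H : Matrix n n ℂ) (α t : ℝ) (X : Matrix n n ℂ) : Matrix n n ℂ :=
  Matrix.of fun a b => ∫ p, evolve H (interaction p) α t X a b ∂interactionLaw n

/-- Conjugating `UDU†` by `W` is left translation of `U` by `W`, which preserves Haar measure. -/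
lemma integral_interaction_conj {E : Type*} [NormedAddCommGroup E] [NormedSpace ℝ E]
    {W : Matrix n n ℂ} (hW : W ∈ Matrix.unitaryGroup n ℂ) (f : Matrix n n ℂ → E) :
    ∫ p, f (W * interaction p * Wᴴ) ∂interactionLaw n = ∫ p, f (interaction p) ∂interactionLaw n := by
  set w : Matrix.unitaryGroup n ℂ := ⟨W, hW⟩
  have hmp : MeasurePreserving
      ((MeasurableEquiv.mulLeft w).prodCongr (MeasurableEquiv.refl (n → ℝ)))
      (interactionLaw n) (interactionLaw n) :=
    (measurePreserving_mul_left (haarUnitary n) w).prod (MeasurePreserving.id _)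
  rw [← hmp.integral_comp' fun p => f (interaction p)]
  refine integral_congr_ae (Eventually.of_forall fun p => ?_)
  have : interaction ((MeasurableEquiv.mulLeft w).prodCongr (MeasurableEquiv.refl (n → ℝ)) p)
      = W * interaction p * Wᴴ := by
    change (W * (p.1 : Matrix n n ℂ)) * Matrix.diagonal (fun i => (p.2 i : ℂ))
      * (W * (p.1 : Matrix n n ℂ))ᴴ = _
    rw [interaction, Matrix.conjTranspose_mul]
    simp only [mul_assoc]
  simp only [this]

/-- This covariance is used twice: with diagonal signs to remove coherences, and with `V ⊗ 1` to
pass to the energy eigenbasis of the system. -/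
lemma averageEvolve_conj {H : Matrix n n ℂ} (hH : H.IsHermitian) (α t : ℝ)
    {W : Matrix n n ℂ} (hW : W ∈ Matrix.unitaryGroup n ℂ) (X : Matrix n n ℂ) :
    averageEvolve (W * H * Wᴴ) α t (W * X * Wᴴ) = W * averageEvolve H α t X * Wᴴ := by
  ext a b
  have h1 := integral_interaction_conj hW
    (fun G => evolve (W * H * Wᴴ) G α t (W * X * Wᴴ) a b)
  rw [averageEvolve, Matrix.of_apply, ← h1]
  simp only [fun p => evolve_conj (isHermitian_add_interaction hH α p) t hW X]
  simp only [Matrix.mul_apply, Finset.sum_mul]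
  have hi : ∀ c d, Integrable (fun p => W a c * evolve H (interaction p) α t X c d * Wᴴ d b)
      (interactionLaw n) := fun c d =>
    ((integrable_evolve hH α t X c d).const_mul _).mul_const _
  rw [integral_finsetSum _ fun d _ => integrable_finsetSum _ fun c _ => hi c d]
  refine Finset.sum_congr rfl fun d _ => ?_
  rw [integral_finsetSum _ fun c _ => hi c d]
  refine Finset.sum_congr rfl fun c _ => ?_
  rw [integral_mul_const, integral_const_mul]
  rfl

/-- The averaged transition probability from the level `b` to the level `a`. -/
def transitionProb (E : n → ℝ) (α t : ℝ) (a b : n) : ℝ :=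
  ∫ p, ‖propagator ((Matrix.diagonal fun i => (E i : ℂ)) + (α : ℂ) • interaction p) t a b‖ ^ 2
    ∂interactionLaw n

lemma integrable_normSq_propagator {H : Matrix n n ℂ} (hH : H.IsHermitian) (α t : ℝ) (a b : n) :
    Integrable (fun p => ‖propagator (H + (α : ℂ) • interaction p) t a b‖ ^ 2)
      (interactionLaw n) := by
  refine Integrable.of_bound (C := 1)
    (((continuous_propagator_interaction H α t).matrix_elem a b).norm.pow 2).aestronglyMeasurable
    (Eventually.of_forall fun p => ?_)
  rw [Real.norm_of_nonneg (by positivity)]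
  exact pow_le_one₀ (norm_nonneg _) ((norm_entry_le_l2_opNorm _ _ _).trans
    (norm_propagator_le_one (isHermitian_add_interaction hH α p) t))

lemma transitionProb_nonneg (E : n → ℝ) (α t : ℝ) (a b : n) : 0 ≤ transitionProb E α t a b :=
  integral_nonneg fun _ => by positivity

lemma sum_transitionProb_left (E : n → ℝ) (α t : ℝ) (b : n) :
    ∑ a, transitionProb E α t a b = 1 := by
  have hH := isHermitian_diagonal_ofReal E
  simp only [transitionProb]
  rw [← integral_finsetSum _ fun a _ => integrable_normSq_propagator hH α t a b]
  simp only [fun p => sum_normSq_col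
    (propagator_mem_unitaryGroup (isHermitian_add_interaction hH α p) t) b]
  simp

lemma sum_transitionProb_right (E : n → ℝ) (α t : ℝ) (a : n) :
    ∑ b, transitionProb E α t a b = 1 := by
  have hH := isHermitian_diagonal_ofReal E
  simp only [transitionProb]
  rw [← integral_finsetSum _ fun b _ => integrable_normSq_propagator hH α t a b]
  simp only [fun p => sum_normSq_row
    (propagator_mem_unitaryGroup (isHermitian_add_interaction hH α p) t) a]
  simp

/-- The average over the interaction destroys coherences: populations evolve classically. -/
lemma averageEvolve_diagonal (E : n → ℝ) (α t : ℝ) (x : n → ℝ) :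
    averageEvolve (Matrix.diagonal fun i => (E i : ℂ)) α t (Matrix.diagonal fun i => (x i : ℂ))
      = Matrix.diagonal fun a => ((∑ b, transitionProb E α t a b * x b : ℝ) : ℂ) := by
  have hH := isHermitian_diagonal_ofReal E
  ext a b
  by_cases hab : a = b
  · subst hab
    rw [Matrix.diagonal_apply_eq, averageEvolve, Matrix.of_apply]
    have hpt : ∀ p, evolve (Matrix.diagonal fun i => (E i : ℂ)) (interaction p) α t
        (Matrix.diagonal fun i => (x i : ℂ)) a a
        = ((∑ b, ‖propagator ((Matrix.diagonal fun i => (E i : ℂ)) + (α : ℂ) • interaction p)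
            t a b‖ ^ 2 * x b : ℝ) : ℂ) := by
      intro p
      rw [evolve_eq (isHermitian_add_interaction hH α p), Matrix.mul_apply]
      push_cast
      refine Finset.sum_congr rfl fun c _ => ?_
      rw [Matrix.mul_diagonal, Matrix.conjTranspose_apply, mul_right_comm, RCLike.star_def,
        Complex.mul_conj']
    simp only [hpt]
    rw [integral_complex_ofReal, integral_finsetSum _ fun b _ =>
      (integrable_normSq_propagator hH α t a b).mul_const _]
    simp only [integral_mul_const, transitionProb]
  · rw [Matrix.diagonal_apply_ne _ hab]
    -- Flipping the sign of the basis vector `a` fixes all diagonal matrices but negates the entry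
    -- `(a, b)`, which must therefore vanish.
    set v : n → ℂ := fun i => if i = a then -1 else 1 with hv
    have hW : Matrix.diagonal v ∈ Matrix.unitaryGroup n ℂ :=
      diagonal_mem_unitaryGroup fun i => by simp only [hv]; split_ifs <;> simp
    have hconj : ∀ y : n → ℂ, Matrix.diagonal v * Matrix.diagonal y * (Matrix.diagonal v)ᴴ
        = Matrix.diagonal y := by
      intro y
      rw [Matrix.diagonal_conjTranspose, Matrix.diagonal_mul_diagonal,
        Matrix.diagonal_mul_diagonal]
      congr 1
      ext i
      simp only [hv, Pi.star_apply]
      split_ifs <;> simp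
    have h := averageEvolve_conj hH α t hW (Matrix.diagonal fun i => (x i : ℂ))
    rw [hconj, hconj] at h
    have h' := congrFun (congrFun h a) b
    rw [Matrix.diagonal_conjTranspose, Matrix.mul_diagonal, Matrix.diagonal_mul] at h'
    simp only [hv, Pi.star_apply, if_true, if_neg (Ne.symm hab), star_one, mul_one] at h'
    have h2 : (2 : ℂ) * averageEvolve (Matrix.diagonal fun i => (E i : ℂ)) α t
        (Matrix.diagonal fun i => (x i : ℂ)) a b = 0 := by linear_combination h'
    simpa using h2

end Average

/-! ### The thermalizing channel on populations -/

section Channel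

variable {n m : Type*} [Fintype n] [DecidableEq n] [Fintype m] [DecidableEq m]

lemma partialTraceEnv_conj {n : Type*} [Fintype n] (V : Matrix n n ℂ) (Y : Matrix (n × m) (n × m) ℂ) :
    partialTraceEnv ((V ⊗ₖ (1 : Matrix m m ℂ)) * Y * (V ⊗ₖ (1 : Matrix m m ℂ))ᴴ)
      = V * partialTraceEnv Y * Vᴴ := by
  ext i j
  have hone : ∀ k l : m, star ((1 : Matrix m m ℂ) k l) = (1 : Matrix m m ℂ) k l := by
    intro k l; simp only [Matrix.one_apply]; split_ifs <;> simp
  simp only [partialTraceEnv, Matrix.of_apply, Matrix.mul_apply, Fintype.sum_prod_type,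
    Matrix.kronecker_apply, Matrix.conjTranspose_apply, star_mul', hone]
  simp only [Matrix.one_apply, mul_ite, mul_one, mul_zero, ite_mul, zero_mul,
    Finset.sum_ite_eq, Finset.mem_univ, if_true]
  rw [Finset.sum_comm]
  refine Finset.sum_congr rfl fun c _ => ?_
  simp only [Finset.mul_sum, Finset.sum_mul]
  rw [Finset.sum_comm]

lemma totalHamiltonian_conj {V : Matrix n n ℂ} (hV : V ∈ Matrix.unitaryGroup n ℂ)
    (HS : Matrix n n ℂ) (HE : Matrix m m ℂ) :
    totalHamiltonian (V * HS * Vᴴ) HE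
      = (V ⊗ₖ (1 : Matrix m m ℂ)) * totalHamiltonian HS HE * (V ⊗ₖ (1 : Matrix m m ℂ))ᴴ := by
  have h : V * Vᴴ = 1 := Matrix.mem_unitaryGroup_iff.1 hV
  simp only [totalHamiltonian, mul_add, add_mul, Matrix.conjTranspose_kronecker,
    Matrix.conjTranspose_one, ← Matrix.mul_kronecker_mul, mul_one, one_mul, h]

lemma totalHamiltonian_diagonal {n m : Type*} [DecidableEq n] [DecidableEq m] (e : n → ℝ) (h : m → ℝ) :
    totalHamiltonian (Matrix.diagonal fun i => (e i : ℂ)) (Matrix.diagonal fun k => (h k : ℂ))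
      = Matrix.diagonal fun x : n × m => ((e x.1 + h x.2 : ℝ) : ℂ) := by
  rw [totalHamiltonian, ← Matrix.diagonal_one, ← Matrix.diagonal_one,
    Matrix.diagonal_kronecker_diagonal, Matrix.diagonal_kronecker_diagonal, Matrix.diagonal_add]
  congr 1
  ext x
  simp

/-- The channel acts on states commuting with the Hamiltonian by the averaged transition
probabilities. -/
lemma channel_diagonal {V : Matrix n n ℂ} (hV : V ∈ Matrix.unitaryGroup n ℂ) (e : n → ℝ)
    (h : m → ℝ) (α β t : ℝ) {q : m → ℝ}
    (hq : gibbs (Matrix.diagonal fun k => (h k : ℂ)) β = Matrix.diagonal fun k => (q k : ℂ))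
    (p : n → ℝ) :
    channel (V * (Matrix.diagonal fun i => (e i : ℂ)) * Vᴴ) (Matrix.diagonal fun k => (h k : ℂ))
        α β t (V * (Matrix.diagonal fun i => (p i : ℂ)) * Vᴴ)
      = V * (Matrix.diagonal fun i => ((∑ k, ∑ x : n × m,
          transitionProb (fun x : n × m => e x.1 + h x.2) α t (i, k) x * (p x.1 * q x.2) : ℝ) : ℂ))
        * Vᴴ := by
  have hW : V ⊗ₖ (1 : Matrix m m ℂ) ∈ Matrix.unitaryGroup (n × m) ℂ :=
    Matrix.kronecker_mem_unitary hV (one_mem _)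
  have hX : (V * (Matrix.diagonal fun i => (p i : ℂ)) * Vᴴ) ⊗ₖ
        gibbs (Matrix.diagonal fun k => (h k : ℂ)) β
      = (V ⊗ₖ (1 : Matrix m m ℂ)) * (Matrix.diagonal fun x : n × m => ((p x.1 * q x.2 : ℝ) : ℂ))
        * (V ⊗ₖ (1 : Matrix m m ℂ))ᴴ := by
    have : (Matrix.diagonal fun x : n × m => ((p x.1 * q x.2 : ℝ) : ℂ))
        = (Matrix.diagonal fun i => (p i : ℂ)) ⊗ₖ (Matrix.diagonal fun k => (q k : ℂ)) := by
      rw [Matrix.diagonal_kronecker_diagonal]; congr 1; ext x; simp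
    rw [hq, this, Matrix.conjTranspose_kronecker, Matrix.conjTranspose_one,
      ← Matrix.mul_kronecker_mul, ← Matrix.mul_kronecker_mul, one_mul, mul_one]
  have hch : channel (V * (Matrix.diagonal fun i => (e i : ℂ)) * Vᴴ)
      (Matrix.diagonal fun k => (h k : ℂ)) α β t (V * (Matrix.diagonal fun i => (p i : ℂ)) * Vᴴ)
      = partialTraceEnv (averageEvolve (totalHamiltonian
          (V * (Matrix.diagonal fun i => (e i : ℂ)) * Vᴴ) (Matrix.diagonal fun k => (h k : ℂ))) α t
          ((V * (Matrix.diagonal fun i => (p i : ℂ)) * Vᴴ) ⊗ₖ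
            gibbs (Matrix.diagonal fun k => (h k : ℂ)) β)) := rfl
  rw [hch, hX, totalHamiltonian_conj hV, totalHamiltonian_diagonal,
    averageEvolve_conj (isHermitian_diagonal_ofReal _) α t hW, averageEvolve_diagonal,
    partialTraceEnv_conj]
  congr 2
  ext i j
  by_cases hij : i = j
  · subst hij; simp [partialTraceEnv]
  · simp [partialTraceEnv, hij]

end Channel

end Thermalization

end

noncomputable section

namespace Thermalization

/-! ### Bounds on the transition probabilities -/

section Bounds

open scoped Matrix.Norms.L2Operator

variable {n : Type*} [Fintype n] [DecidableEq n]

/-- The fourth moment `E (∑ᵢ dᵢ²)²` of the random eigenvalues. -/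
def fourthMoment (n : Type*) [Fintype n] : ℝ := ∫ d, (∑ i, d i ^ 2) ^ 2 ∂normalLaw n

lemma fourthMoment_nonneg (n : Type*) [Fintype n] : 0 ≤ fourthMoment n :=
  integral_nonneg fun _ => by positivity

lemma exists_norm_propagator_interaction_eq (E : n → ℝ) (α : ℝ) {t : ℝ} (ht : 0 ≤ t) {a b : n}
    (hab : a ≠ b) (p : Matrix.unitaryGroup n ℂ × (n → ℝ)) :
    ∃ z r : ℂ, ‖z‖ ^ 2 = α ^ 2 * ‖phaseIntegral (E a - E b) t‖ ^ 2 * ‖interaction p a b‖ ^ 2 ∧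
      ‖r‖ ^ 2 ≤ (α * t) ^ 4 * (∑ i, p.2 i ^ 2) ^ 2 ∧
      ‖propagator ((Matrix.diagonal fun i => (E i : ℂ)) + (α : ℂ) • interaction p) t a b‖
        = ‖z + r‖ := by
  obtain ⟨r, hr, h⟩ := exists_norm_propagator_add_apply_eq E
    (isHermitian_ofReal_smul (isHermitian_interaction p) α) ht hab
  refine ⟨_, r, ?_, ?_, h⟩
  · rw [norm_mul, norm_mul, Complex.norm_I, Matrix.smul_apply, norm_smul, Complex.norm_real,
      Real.norm_eq_abs, mul_pow, mul_pow, mul_pow, sq_abs]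
    ring
  · have hV : ‖(α : ℂ) • interaction p‖ ^ 2 ≤ α ^ 2 * ∑ i, p.2 i ^ 2 := by
      rw [norm_smul, Complex.norm_real, mul_pow, Real.norm_eq_abs, sq_abs]
      exact mul_le_mul_of_nonneg_left (norm_interaction_sq_le p) (sq_nonneg _)
    have hr' : ‖r‖ ≤ α ^ 2 * (∑ i, p.2 i ^ 2) * t ^ 2 :=
      hr.trans (mul_le_mul_of_nonneg_right hV (sq_nonneg _))
    calc ‖r‖ ^ 2 ≤ (α ^ 2 * (∑ i, p.2 i ^ 2) * t ^ 2) ^ 2 := by gcongr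
      _ = _ := by ring

lemma norm_add_sq_le_two_mul (z r : ℂ) : ‖z + r‖ ^ 2 ≤ 2 * ‖z‖ ^ 2 + 2 * ‖r‖ ^ 2 := by
  have h : ‖z + r‖ ^ 2 ≤ (‖z‖ + ‖r‖) ^ 2 := by gcongr; exact norm_add_le _ _
  nlinarith [sq_nonneg (‖z‖ - ‖r‖)]

lemma integrable_sum_sq_sq_interactionLaw (n : Type*) [Fintype n] [DecidableEq n] :
    Integrable (fun p => (∑ i, p.2 i ^ 2) ^ 2) (interactionLaw n) :=
  integrable_interactionLaw_of_normalLaw integrable_normalLaw_sum_sq_sq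

lemma integral_sum_sq_sq_interactionLaw (n : Type*) [Fintype n] [DecidableEq n] :
    ∫ p, (∑ i, p.2 i ^ 2) ^ 2 ∂interactionLaw n = fourthMoment n :=
  integral_interactionLaw_of_normalLaw fun d => (∑ i, d i ^ 2) ^ 2

lemma transitionProb_le (E : n → ℝ) (α : ℝ) {t : ℝ} (ht : 0 ≤ t) {a b : n} (hab : a ≠ b) :
    transitionProb E α t a b
      ≤ 2 * (α ^ 2 * ‖phaseIntegral (E a - E b) t‖ ^ 2) * (1 / (Fintype.card n + 1))
        + 2 * (α * t) ^ 4 * fourthMoment n := by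
  have hG := (integrable_normSq_interaction a b).const_mul
    (2 * (α ^ 2 * ‖phaseIntegral (E a - E b) t‖ ^ 2))
  have hN := (integrable_sum_sq_sq_interactionLaw n).const_mul (2 * (α * t) ^ 4)
  rw [← integral_normSq_interaction hab, ← integral_sum_sq_sq_interactionLaw, ← integral_const_mul,
    ← integral_const_mul, ← integral_add hG hN]
  refine integral_mono (integrable_normSq_propagator (isHermitian_diagonal_ofReal E) α t a b)
    (hG.add hN) fun p => ?_
  obtain ⟨z, r, hz, hr, h⟩ := exists_norm_propagator_interaction_eq E α ht hab p
  simp only [h]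
  linarith [norm_add_sq_le_two_mul z r]

lemma le_transitionProb (E : n → ℝ) (α : ℝ) {t : ℝ} (ht : 0 ≤ t) {a b : n} (hab : a ≠ b) :
    1 / 2 * (α ^ 2 * ‖phaseIntegral (E a - E b) t‖ ^ 2) * (1 / (Fintype.card n + 1))
        - (α * t) ^ 4 * fourthMoment n
      ≤ transitionProb E α t a b := by
  have hG := (integrable_normSq_interaction a b).const_mul
    (1 / 2 * (α ^ 2 * ‖phaseIntegral (E a - E b) t‖ ^ 2))
  have hN := (integrable_sum_sq_sq_interactionLaw n).const_mul ((α * t) ^ 4)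
  rw [← integral_normSq_interaction hab, ← integral_sum_sq_sq_interactionLaw, ← integral_const_mul,
    ← integral_const_mul, ← integral_sub hG hN]
  refine integral_mono (hG.sub hN)
    (integrable_normSq_propagator (isHermitian_diagonal_ofReal E) α t a b) fun p => ?_
  obtain ⟨z, r, hz, hr, h⟩ := exists_norm_propagator_interaction_eq E α ht hab p
  -- Reverse use of the inequality: `z = (z + r) + (-r)` gives `‖z + r‖² ≥ ‖z‖²/2 - ‖r‖²`.
  have h2 := norm_add_sq_le_two_mul (z + r) (-r)
  rw [add_neg_cancel_right, norm_neg] at h2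
  simp only [h]
  linarith

end Bounds

/-! ### Single-qubit thermal states and trace norms -/

section Qubit

lemma gibbs_diagonal (e : Fin 2 → ℝ) (β : ℝ) :
    gibbs (Matrix.diagonal fun i => (e i : ℂ)) β = Matrix.diagonal fun i =>
      ((![1 - Real.sigmoid (-(β * (e 1 - e 0))), Real.sigmoid (-(β * (e 1 - e 0)))] i : ℝ) : ℂ) := by
  have hexp : NormedSpace.exp (-(β : ℂ) • (Matrix.diagonal fun i => (e i : ℂ)))
      = Matrix.diagonal fun i => ((Real.exp (-β * e i) : ℝ) : ℂ) := by
    rw [← Matrix.diagonal_smul, Matrix.exp_diagonal]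
    congr 1
    ext i
    rw [Pi.coe_exp, ← Complex.exp_eq_exp_ℂ]
    simp
  have h0 := Real.exp_pos (-β * e 0)
  have h1 := Real.exp_pos (-β * e 1)
  have hdiff : Real.exp (- -(β * (e 1 - e 0))) = Real.exp (-β * e 0) / Real.exp (-β * e 1) := by
    rw [← Real.exp_sub]; ring_nf
  rw [gibbs, hexp, Matrix.trace_diagonal, ← Matrix.diagonal_smul]
  congr 1
  ext i
  rw [Fin.sum_univ_two, Pi.smul_apply, smul_eq_mul, ← Complex.ofReal_add, ← Complex.ofReal_inv,
    ← Complex.ofReal_mul, Real.sigmoid_def, hdiff]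
  congr 1
  fin_cases i
  · simp
    field_simp
    ring
  · simp
    field_simp
    ring

lemma gibbs_conj {n : Type*} [Fintype n] [DecidableEq n] {V : Matrix n n ℂ}
    (hV : V ∈ Matrix.unitaryGroup n ℂ) (A : Matrix n n ℂ) (β : ℝ) :
    gibbs (V * A * Vᴴ) β = V * gibbs A β * Vᴴ := by
  have hinv : V⁻¹ = Vᴴ := Matrix.inv_eq_right_inv (Matrix.mem_unitaryGroup_iff.1 hV)
  have hu : IsUnit V := IsUnit.of_mul_eq_one _ (Matrix.mem_unitaryGroup_iff.1 hV)
  have h : Vᴴ * V = 1 := Matrix.mem_unitaryGroup_iff'.1 hV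
  have hexp : NormedSpace.exp (-(β : ℂ) • (V * A * Vᴴ))
      = V * NormedSpace.exp (-(β : ℂ) • A) * Vᴴ := by
    rw [← hinv, ← Matrix.exp_conj _ _ hu]; simp
  rw [gibbs, gibbs, hexp, Matrix.trace_mul_comm, ← mul_assoc, h, one_mul]
  simp

/-- Cauchy–Schwarz on the singular values. No constant is lost for differences of qubit populations,
whose two singular values coincide. -/
lemma traceNorm_le_sqrt {n : Type*} [Fintype n] [DecidableEq n] (A : Matrix n n ℂ) :
    traceNorm A ≤ √(Fintype.card n * (Aᴴ * A).trace.re) := by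
  have hA := Matrix.isHermitian_conjTranspose_mul_self A
  have hpos : ∀ i, 0 ≤ hA.eigenvalues i :=
    (Matrix.posSemidef_conjTranspose_mul_self A).eigenvalues_nonneg
  refine Real.le_sqrt_of_sq_le ?_
  rw [traceNorm, hA.trace_eq_sum_eigenvalues]
  refine (sq_sum_le_card_mul_sum_sq).trans_eq ?_
  simp [Real.sq_sqrt (hpos _)]

lemma traceNorm_conj_diagonal_le {V : Matrix (Fin 2) (Fin 2) ℂ}
    (hV : V ∈ Matrix.unitaryGroup (Fin 2) ℂ) (x : ℝ) :
    traceNorm (V * (Matrix.diagonal fun i => ((![-x, x] i : ℝ) : ℂ)) * Vᴴ) ≤ 2 * |x| := by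
  refine (traceNorm_le_sqrt _).trans (Real.sqrt_le_iff.2 ⟨by positivity, ?_⟩)
  have h : Vᴴ * V = 1 := Matrix.mem_unitaryGroup_iff'.1 hV
  rw [Matrix.conjTranspose_mul, Matrix.conjTranspose_mul, Matrix.conjTranspose_conjTranspose,
    ← mul_assoc V, unitary_conj_mul_conj hV, Matrix.trace_mul_comm, ← mul_assoc, h, one_mul,
    Matrix.diagonal_conjTranspose, Matrix.diagonal_mul_diagonal, Matrix.trace_diagonal,
    Fin.sum_univ_two, mul_pow, sq_abs]
  simp
  nlinarith

lemma abs_sigmoid_sub_le (x y : ℝ) : |Real.sigmoid x - Real.sigmoid y| ≤ |x - y| := by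
  have h := (convex_univ (𝕜 := ℝ) (E := ℝ)).norm_image_sub_le_of_norm_hasDerivWithin_le
    (f := Real.sigmoid) (C := 1)
    (fun z _ => (Real.hasDerivAt_sigmoid z).hasDerivWithinAt) (fun z _ => by
      have h1 := Real.sigmoid_pos z
      have h2 := Real.sigmoid_lt_one z
      rw [Real.norm_eq_abs, abs_le]
      constructor <;> nlinarith) (Set.mem_univ y) (Set.mem_univ x)
  simpa using h

/-- A single-qubit Hamiltonian in its energy eigenbasis, in increasing order of energy. -/
lemma exists_diagonalization {HS : Matrix (Fin 2) (Fin 2) ℂ} (hHS : HS.IsHermitian) :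
    ∃ V ∈ Matrix.unitaryGroup (Fin 2) ℂ, ∃ e : Fin 2 → ℝ, e 1 - e 0 = qubitGap hHS ∧
      HS = V * (Matrix.diagonal fun i => (e i : ℂ)) * Vᴴ := by
  set U := hHS.eigenvectorUnitary with hU
  have hspec : HS = (U : Matrix (Fin 2) (Fin 2) ℂ)
      * (Matrix.diagonal fun i => (hHS.eigenvalues i : ℂ)) * (U : Matrix (Fin 2) (Fin 2) ℂ)ᴴ := by
    conv_lhs => rw [hHS.spectral_theorem]
    rfl
  rcases le_total (hHS.eigenvalues 0) (hHS.eigenvalues 1) with h | h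
  · exact ⟨U, U.2, hHS.eigenvalues, by rw [qubitGap, abs_of_nonpos (by linarith)]; ring, hspec⟩
  · have hS := swapMatrix_mem_unitaryGroup (0 : Fin 2) 1
    refine ⟨(U : Matrix (Fin 2) (Fin 2) ℂ) * swapMatrix 0 1, mul_mem U.2 hS, ![hHS.eigenvalues 1, hHS.eigenvalues 0],
      by rw [qubitGap, abs_of_nonneg (by linarith)]; simp, ?_⟩
    have hsw : swapMatrix (0 : Fin 2) 1
        * (Matrix.diagonal fun i => ((![hHS.eigenvalues 1, hHS.eigenvalues 0] i : ℝ) : ℂ))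
        * (swapMatrix (0 : Fin 2) 1)ᴴ = Matrix.diagonal fun i => (hHS.eigenvalues i : ℂ) := by
      rw [← Matrix.star_eq_conjTranspose, star_swapMatrix, swapMatrix_mul]
      ext i j
      fin_cases i <;> fin_cases j <;>
        simp [Matrix.mul_apply, swapMatrix, Fin.sum_univ_two, Matrix.one_apply]
    rw [Matrix.conjTranspose_mul]
    conv_lhs => rw [hspec, ← hsw]
    simp only [mul_assoc]

/-- A matrix commuting with a nondegenerate diagonal one is diagonal; positivity and unit trace then
leave a single population. -/
lemma exists_populations {V ρ : Matrix (Fin 2) (Fin 2) ℂ}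
    (hV : V ∈ Matrix.unitaryGroup (Fin 2) ℂ) {e : Fin 2 → ℝ} (he : e 0 ≠ e 1)
    (hρ : IsDensityMatrix ρ) (hc : Commute ρ (V * (Matrix.diagonal fun i => (e i : ℂ)) * Vᴴ)) :
    ∃ p ∈ Set.Icc (0 : ℝ) 1, ρ = V * (Matrix.diagonal fun i => ((![1 - p, p] i : ℝ) : ℂ)) * Vᴴ := by
  have h1 : Vᴴ * V = 1 := Matrix.mem_unitaryGroup_iff'.1 hV
  have h2 : V * Vᴴ = 1 := Matrix.mem_unitaryGroup_iff.1 hV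
  set τ := Vᴴ * ρ * V with hτ
  have hρτ : ρ = V * τ * Vᴴ := by
    rw [hτ]
    calc ρ = (V * Vᴴ) * ρ * (V * Vᴴ) := by rw [h2]; simp
      _ = _ := by simp only [mul_assoc]
  have hpsd : τ.PosSemidef := hρ.1.conjTranspose_mul_mul_same V
  have htr : τ.trace = 1 := by
    rw [hτ, Matrix.trace_mul_comm, ← mul_assoc, h2, one_mul, hρ.2]
  have hcomm : τ * (Matrix.diagonal fun i => (e i : ℂ))
      = (Matrix.diagonal fun i => (e i : ℂ)) * τ := by
    have := congrArg (fun M => Vᴴ * M * V) hc.eq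
    simp only [hρτ, unitary_conj_mul_conj hV] at this
    have key : ∀ M : Matrix (Fin 2) (Fin 2) ℂ, Vᴴ * (V * M * Vᴴ) * V = M := fun M => by
      calc _ = (Vᴴ * V) * M * (Vᴴ * V) := by simp only [mul_assoc]
        _ = M := by rw [h1]; simp
    rwa [key, key] at this
  have hoff : ∀ i j, e i ≠ e j → τ i j = 0 := by
    intro i j hij
    have := congrFun (congrFun hcomm i) j
    rw [Matrix.mul_diagonal, Matrix.diagonal_mul] at this
    have h3 : ((e i : ℂ) - e j) * τ i j = 0 := by linear_combination -this
    rcases mul_eq_zero.1 h3 with h | h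
    · exact absurd (by exact_mod_cast sub_eq_zero.1 h) hij
    · exact h
  have hd : ∀ i, 0 ≤ (τ i i).re ∧ τ i i = ((τ i i).re : ℂ) := fun i => by
    have := hpsd.diag_nonneg (i := i)
    rw [Complex.nonneg_iff] at this
    exact ⟨this.1, Complex.ext rfl (by simpa using this.2.symm)⟩
  rw [Matrix.trace_fin_two] at htr
  have htr' : (τ 0 0).re + (τ 1 1).re = 1 := by
    have := congrArg Complex.re htr; simpa using this
  refine ⟨(τ 1 1).re, ⟨(hd 1).1, by linarith [(hd 0).1]⟩, ?_⟩
  rw [hρτ]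
  congr 2
  ext i j
  fin_cases i <;> fin_cases j
  · simp [← htr']; exact (hd 0).2
  · simpa using hoff 0 1 he
  · simpa using hoff 1 0 he.symm
  · simpa using (hd 1).2

end Qubit

end Thermalization

end

noncomputable section

namespace Thermalization

/-! ### The induced two-level Markov chain -/

section Chain

/-- The excitation probability of the system when the environment is excited with
probability `s`. -/
def excitationRate (P : Fin 2 × Fin 2 → Fin 2 × Fin 2 → ℝ) (s : ℝ) : ℝ :=
  (1 - s) * (P (1, 0) (0, 0) + P (1, 1) (0, 0)) + s * (P (1, 0) (0, 1) + P (1, 1) (0, 1))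

/-- The relaxation probability of the system when the environment is excited with
probability `s`. -/
def relaxationRate (P : Fin 2 × Fin 2 → Fin 2 × Fin 2 → ℝ) (s : ℝ) : ℝ :=
  (1 - s) * (P (0, 0) (1, 0) + P (0, 1) (1, 0)) + s * (P (0, 0) (1, 1) + P (0, 1) (1, 1))

/-- One step of the two-level Markov chain with given excitation and relaxation probabilities. -/
def chainStep (up down p : ℝ) : ℝ := p + up * (1 - p) - down * p

lemma chainStep_mem_Icc {up down p : ℝ} (hup : up ∈ Set.Icc (0 : ℝ) 1)
    (hdown : down ∈ Set.Icc (0 : ℝ) 1) (hp : p ∈ Set.Icc (0 : ℝ) 1) :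
    chainStep up down p ∈ Set.Icc (0 : ℝ) 1 := by
  obtain ⟨h1, h2⟩ := hup
  obtain ⟨h3, h4⟩ := hdown
  obtain ⟨h5, h6⟩ := hp
  constructor <;> rw [chainStep] <;> nlinarith

lemma iterate_chainStep_mem_Icc {up down p : ℝ} (hup : up ∈ Set.Icc (0 : ℝ) 1)
    (hdown : down ∈ Set.Icc (0 : ℝ) 1) (hp : p ∈ Set.Icc (0 : ℝ) 1) (L : ℕ) :
    (chainStep up down)^[L] p ∈ Set.Icc (0 : ℝ) 1 := by
  induction L with
  | zero => exact hp
  | succ L ih => rw [Function.iterate_succ_apply']; exact chainStep_mem_Icc hup hdown ih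

/-- Convergence of the chain to the vicinity of any approximately stationary `s`. -/
lemma abs_iterate_chainStep_sub_le {up down s r δ : ℝ} (hr : 0 < r) (hr' : r ≤ up + down)
    (hle : up + down ≤ 1) (hδ : |up - s * (up + down)| ≤ δ) (p : ℝ) (L : ℕ) :
    |(chainStep up down)^[L] p - s| ≤ (1 - r) ^ L * |p - s| + δ / r := by
  have hδ0 : 0 ≤ δ := (abs_nonneg _).trans hδ
  induction L with
  | zero => simp; positivity
  | succ L ih =>
    rw [Function.iterate_succ_apply']
    set x := (chainStep up down)^[L] p
    -- The step is affine: it contracts the distance to `s` and adds a drift bounded by `δ`. The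
    -- value `δ / r` is the fixed point of `y ↦ (1 - r) y + δ`, so it bounds the accumulated drift.
    have e : chainStep up down x - s
        = (1 - (up + down)) * (x - s) + (up - s * (up + down)) := by rw [chainStep]; ring
    have hx : (1 - r) * (δ / r) + δ = δ / r := by field_simp; ring
    calc |chainStep up down x - s| ≤ |(1 - (up + down)) * (x - s)| + |up - s * (up + down)| := by
          rw [e]; exact abs_add_le _ _
      _ ≤ (1 - r) * |x - s| + δ := by
          rw [abs_mul, abs_of_nonneg (by linarith : 0 ≤ 1 - (up + down))]
          gcongr
      _ ≤ (1 - r) * ((1 - r) ^ L * |p - s| + δ / r) + δ := by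
          gcongr
          linarith
      _ = (1 - r) ^ (L + 1) * |p - s| + ((1 - r) * (δ / r) + δ) := by ring
      _ = _ := by rw [hx]

variable {P : Fin 2 × Fin 2 → Fin 2 × Fin 2 → ℝ}

lemma sum_populations_eq (hcol : ∀ b, ∑ a, P a b = 1) (p s : ℝ) (i : Fin 2) :
    ∑ k, ∑ x : Fin 2 × Fin 2, P (i, k) x * (![1 - p, p] x.1 * ![1 - s, s] x.2)
      = ![1 - chainStep (excitationRate P s) (relaxationRate P s) p,
          chainStep (excitationRate P s) (relaxationRate P s) p] i := by
  simp only [Fintype.sum_prod_type, Fin.sum_univ_two] at hcol ⊢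
  have h0 := hcol (0, 0)
  have h1 := hcol (0, 1)
  have h2 := hcol (1, 0)
  have h3 := hcol (1, 1)
  fin_cases i
  · simp [chainStep, excitationRate, relaxationRate]
    linear_combination ((1 - p) * (1 - s)) * h0 + ((1 - p) * s) * h1
  · simp [chainStep, excitationRate, relaxationRate]
    linear_combination (p * (1 - s)) * h2 + (p * s) * h3

lemma excitationRate_mem_Icc (hP : ∀ a b, 0 ≤ P a b) (hcol : ∀ b, ∑ a, P a b = 1) {s : ℝ}
    (hs : s ∈ Set.Icc (0 : ℝ) 1) : excitationRate P s ∈ Set.Icc (0 : ℝ) 1 := by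
  obtain ⟨h0, h1⟩ := hs
  simp only [Fintype.sum_prod_type, Fin.sum_univ_two] at hcol
  have a1 : P (1, 0) (0, 0) + P (1, 1) (0, 0) ≤ 1 := by
    linarith [hcol (0, 0), hP (0, 0) (0, 0), hP (0, 1) (0, 0)]
  have a2 : P (1, 0) (0, 1) + P (1, 1) (0, 1) ≤ 1 := by
    linarith [hcol (0, 1), hP (0, 0) (0, 1), hP (0, 1) (0, 1)]
  have b1 := add_nonneg (hP (1, 0) (0, 0)) (hP (1, 1) (0, 0))
  have b2 := add_nonneg (hP (1, 0) (0, 1)) (hP (1, 1) (0, 1))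
  constructor <;> rw [excitationRate] <;> nlinarith

lemma relaxationRate_mem_Icc (hP : ∀ a b, 0 ≤ P a b) (hcol : ∀ b, ∑ a, P a b = 1) {s : ℝ}
    (hs : s ∈ Set.Icc (0 : ℝ) 1) : relaxationRate P s ∈ Set.Icc (0 : ℝ) 1 := by
  obtain ⟨h0, h1⟩ := hs
  simp only [Fintype.sum_prod_type, Fin.sum_univ_two] at hcol
  have a1 : P (0, 0) (1, 0) + P (0, 1) (1, 0) ≤ 1 := by
    linarith [hcol (1, 0), hP (1, 0) (1, 0), hP (1, 1) (1, 0)]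
  have a2 : P (0, 0) (1, 1) + P (0, 1) (1, 1) ≤ 1 := by
    linarith [hcol (1, 1), hP (1, 0) (1, 1), hP (1, 1) (1, 1)]
  have b1 := add_nonneg (hP (0, 0) (1, 0)) (hP (0, 1) (1, 0))
  have b2 := add_nonneg (hP (0, 0) (1, 1)) (hP (0, 1) (1, 1))
  constructor <;> rw [relaxationRate] <;> nlinarith

/-- If all transitions but the resonant ones `(1,0) ↔ (0,1)` are rare, then the chain is nearly in
detailed balance with the environment. -/
lemma rate_bounds (hP : ∀ a b, 0 ≤ P a b) (hcol : ∀ b, ∑ a, P a b = 1)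
    (hrow : ∀ a, ∑ b, P a b = 1) {s η : ℝ} (hs : s ∈ Set.Icc (0 : ℝ) 1)
    (hη : ∀ a b, a ≠ b → (a, b) ≠ ((1, 0), (0, 1)) → (a, b) ≠ ((0, 1), (1, 0)) → P a b ≤ η) :
    P (1, 0) (0, 1) - 2 * η ≤ excitationRate P s + relaxationRate P s ∧
    excitationRate P s + relaxationRate P s ≤ P (1, 0) (0, 1) + P (0, 1) (1, 0) + 4 * η ∧
    |excitationRate P s - s * (excitationRate P s + relaxationRate P s)| ≤ 4 * η := by
  obtain ⟨h0, h1⟩ := hs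
  simp only [Fintype.sum_prod_type, Fin.sum_univ_two] at hcol hrow
  have hc := hcol (0, 1)
  have hr := hrow (0, 1)
  have b1 := hη (1, 0) (0, 0) (by decide) (by decide) (by decide)
  have b2 := hη (1, 1) (0, 0) (by decide) (by decide) (by decide)
  have b3 := hη (1, 1) (0, 1) (by decide) (by decide) (by decide)
  have b4 := hη (0, 0) (1, 0) (by decide) (by decide) (by decide)
  have b5 := hη (0, 0) (1, 1) (by decide) (by decide) (by decide)
  have b6 := hη (0, 1) (1, 1) (by decide) (by decide) (by decide)
  have b7 := hη (0, 0) (0, 1) (by decide) (by decide) (by decide)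
  have b8 := hη (0, 1) (0, 0) (by decide) (by decide) (by decide)
  have c1 := hP (1, 0) (0, 0)
  have c2 := hP (1, 1) (0, 0)
  have c3 := hP (1, 1) (0, 1)
  have c4 := hP (0, 0) (1, 0)
  have c5 := hP (0, 0) (1, 1)
  have c6 := hP (0, 1) (1, 1)
  have c7 := hP (0, 0) (0, 1)
  have c8 := hP (0, 1) (0, 0)
  have c9 := hP (1, 0) (0, 1)
  have c10 := hP (0, 1) (1, 0)
  have hη0 : 0 ≤ η := c1.trans b1
  set R₁ := P (1, 0) (0, 1)
  set R₂ := P (0, 1) (1, 0)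
  -- Row and column `(0,1)` both sum to `1` and share their diagonal entry. Hence the two resonant
  -- probabilities agree up to rare transitions, without any reciprocity of the dynamics.
  have hR1 : R₁ - R₂ ≤ 2 * η := by linarith
  have hR2 : R₂ - R₁ ≤ 2 * η := by linarith
  set x := (1 - s) * (P (1, 0) (0, 0) + P (1, 1) (0, 0)) + s * P (1, 1) (0, 1) with hx
  set y := (1 - s) * P (0, 0) (1, 0) + s * (P (0, 0) (1, 1) + P (0, 1) (1, 1)) with hy
  have hu : excitationRate P s = s * R₁ + x := by rw [excitationRate, hx]; ring
  have hd : relaxationRate P s = (1 - s) * R₂ + y := by rw [relaxationRate, hy]; ring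
  have hs' : 0 ≤ 1 - s := by linarith
  have hx0 : 0 ≤ x := by positivity
  have hy0 : 0 ≤ y := by positivity
  have hx1 : x ≤ 2 * η := by
    calc x ≤ (1 - s) * (η + η) + s * η := by rw [hx]; gcongr
      _ ≤ 2 * η := by nlinarith
  have hy1 : y ≤ 2 * η := by
    calc y ≤ (1 - s) * η + s * (η + η) := by rw [hy]; gcongr
      _ ≤ 2 * η := by nlinarith
  rw [hu, hd]
  have hss : 0 ≤ s * (1 - s) := mul_nonneg h0 hs'
  have hss1 : s * (1 - s) ≤ 1 := mul_le_one₀ h1 hs' (by linarith)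
  have hup : s * (1 - s) * (R₁ - R₂) ≤ 2 * η :=
    (mul_le_mul_of_nonneg_left hR1 hss).trans (mul_le_of_le_one_left (by linarith) hss1)
  have hlow : s * (1 - s) * (R₂ - R₁) ≤ 2 * η :=
    (mul_le_mul_of_nonneg_left hR2 hss).trans (mul_le_of_le_one_left (by linarith) hss1)
  have hx2 : (1 - s) * x ≤ 2 * η := (mul_le_of_le_one_left hx0 (by linarith)).trans hx1
  have hy2 : s * y ≤ 2 * η := (mul_le_of_le_one_left hy0 h1).trans hy1
  have hx3 : 0 ≤ (1 - s) * x := mul_nonneg hs' hx0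
  have hy3 : 0 ≤ s * y := mul_nonneg h0 hy0
  have hmix : (1 - s) * (R₁ - R₂) ≤ 2 * η :=
    (mul_le_mul_of_nonneg_left hR1 hs').trans (mul_le_of_le_one_left (by linarith) (by linarith))
  have hsR₁ : s * R₁ ≤ R₁ := mul_le_of_le_one_left c9 h1
  have hsR₂ : (1 - s) * R₂ ≤ R₂ := mul_le_of_le_one_left c10 (by linarith)
  -- For `R₁ = R₂` the resonant swap leaves `s` exactly stationary; only the asymmetry and the rare
  -- transitions `x`, `y` remain.
  have e : s * R₁ + x - s * (s * R₁ + x + ((1 - s) * R₂ + y))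
      = s * (1 - s) * (R₁ - R₂) + ((1 - s) * x - s * y) := by ring
  refine ⟨by linarith, by linarith, ?_⟩
  rw [e]
  exact abs_le.2 ⟨by linarith, by linarith⟩

end Chain

/-! ### Iterating the channel on a qubit -/

section QubitChannel

lemma envHamiltonian_eq (γ : ℝ) :
    envHamiltonian γ = Matrix.diagonal fun k => ((![0, γ] k : ℝ) : ℂ) := by
  ext i j
  fin_cases i <;> fin_cases j <;> simp [envHamiltonian]

/-- The energy levels of the uncoupled system and environment qubits. -/
def levels (e : Fin 2 → ℝ) (γ : ℝ) (x : Fin 2 × Fin 2) : ℝ := e x.1 + ![0, γ] x.2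

lemma iterate_channel {V : Matrix (Fin 2) (Fin 2) ℂ} (hV : V ∈ Matrix.unitaryGroup (Fin 2) ℂ)
    (e : Fin 2 → ℝ) (γ α β t p : ℝ) (L : ℕ) :
    (channel (V * (Matrix.diagonal fun i => (e i : ℂ)) * Vᴴ) (envHamiltonian γ) α β t)^[L]
        (V * (Matrix.diagonal fun i => ((![1 - p, p] i : ℝ) : ℂ)) * Vᴴ)
      = V * (Matrix.diagonal fun i => ((![
          1 - (chainStep (excitationRate (transitionProb (levels e γ) α t) (Real.sigmoid (-(β * γ))))
            (relaxationRate (transitionProb (levels e γ) α t) (Real.sigmoid (-(β * γ)))))^[L] p,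
          (chainStep (excitationRate (transitionProb (levels e γ) α t) (Real.sigmoid (-(β * γ))))
            (relaxationRate (transitionProb (levels e γ) α t) (Real.sigmoid (-(β * γ)))))^[L] p]
              i : ℝ) : ℂ)) * Vᴴ := by
  induction L with
  | zero => rfl
  | succ L ih =>
    rw [Function.iterate_succ_apply', Function.iterate_succ_apply', ih, envHamiltonian_eq]
    have hq := gibbs_diagonal ![0, γ] β
    simp only [Matrix.cons_val_one, Matrix.cons_val_zero, sub_zero] at hq
    rw [channel_diagonal hV e ![0, γ] α β t hq]
    congr 3
    ext i
    congr 1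
    exact sum_populations_eq (sum_transitionProb_left (levels e γ) α t) _ _ i

end QubitChannel

end Thermalization

end

noncomputable section

namespace Thermalization

/-! ### The choice of parameters -/

section Parameters

variable {Δ γ σ ε t : ℝ}

lemma pos_of_le_mul_sqrt {x : ℝ} (hσ : 0 < σ) (h : σ ≤ Δ * √x) : 0 < Δ := by
  by_contra hneg
  have := mul_nonpos_of_nonpos_of_nonneg (not_lt.1 hneg) (Real.sqrt_nonneg x)
  linarith

lemma two_mul_sq_div_mem_Ioc (hσ : 0 < σ) (hε : 0 < ε) (hle : σ ≤ Δ * √(ε / 2)) :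
    2 * σ ^ 2 / (Δ ^ 2 * ε) ∈ Set.Ioc (0 : ℝ) 1 := by
  have hΔ := pos_of_le_mul_sqrt hσ hle
  refine ⟨by positivity, (div_le_one (by positivity)).2 ?_⟩
  have h : σ ^ 2 ≤ (Δ * √(ε / 2)) ^ 2 := by gcongr
  rw [mul_pow, Real.sq_sqrt (by positivity)] at h
  linarith

/-- The window of interaction times solves the quadratic inequality
`t² (1 - σ²t²/2) ≥ 1/(Δ²ε)`. -/
lemma window_bounds (hσ : 0 < σ) (hε : 0 < ε) (hle : σ ≤ Δ * √(ε / 2))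
    (ht : t ∈ Set.Icc (timeLower Δ σ ε) (timeUpper Δ σ ε)) :
    0 < t ∧ σ ^ 2 * t ^ 2 < 2 ∧ 1 ≤ Δ ^ 2 * ε * (t ^ 2 * (1 - σ ^ 2 * t ^ 2 / 2)) := by
  have hΔ := pos_of_le_mul_sqrt hσ hle
  obtain ⟨hw0, hw1⟩ := two_mul_sq_div_mem_Ioc hσ hε hle
  obtain ⟨ht1, ht2⟩ := ht
  rw [timeLower, one_div, inv_mul_le_iff₀ hσ] at ht1
  rw [timeUpper, one_div, le_inv_mul_iff₀ hσ] at ht2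
  set w := 2 * σ ^ 2 / (Δ ^ 2 * ε) with hw
  set u := √(1 - w) with hu
  have hu0 : 0 ≤ u := Real.sqrt_nonneg _
  have hu2 : u ^ 2 = 1 - w := Real.sq_sqrt (by linarith)
  have hu1 : u < 1 := by nlinarith
  have hpos : 0 < σ * t := (Real.sqrt_pos.2 (by linarith)).trans_le ht1
  have h1 : 1 - u ≤ (σ * t) ^ 2 := (Real.sqrt_le_left hpos.le).1 ht1
  have h2 : (σ * t) ^ 2 ≤ 1 + u := (Real.le_sqrt hpos.le (by linarith)).1 ht2
  rw [mul_pow] at h1 h2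
  -- With `y = σ²t²` this is `(y - 1)² ≤ u² = 1 - w`, which holds since `1 - u ≤ y ≤ 1 + u`.
  have hq : w ≤ 2 * (σ ^ 2 * t ^ 2) * (1 - σ ^ 2 * t ^ 2 / 2) := by nlinarith
  refine ⟨pos_of_mul_pos_right hpos hσ.le, by linarith, ?_⟩
  rw [hw, div_le_iff₀ (by positivity)] at hq
  have : 2 * σ ^ 2 * 1 ≤ 2 * σ ^ 2 * (Δ ^ 2 * ε * (t ^ 2 * (1 - σ ^ 2 * t ^ 2 / 2))) := by
    linarith
  exact le_of_mul_le_mul_left this (by positivity)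

lemma timeLower_bounds (hσ : 0 < σ) (hε : 0 < ε) (hle : σ ≤ Δ * √(ε / 2)) :
    0 < timeLower Δ σ ε ∧ σ ^ 2 * timeLower Δ σ ε ^ 2 ≤ 1 ∧
      timeLower Δ σ ε ^ 2 ≤ 2 / (Δ ^ 2 * ε) := by
  have hΔ := pos_of_le_mul_sqrt hσ hle
  obtain ⟨hw0, hw1⟩ := two_mul_sq_div_mem_Ioc hσ hε hle
  set w := 2 * σ ^ 2 / (Δ ^ 2 * ε) with hw
  set u := √(1 - w) with hu
  have hu0 : 0 ≤ u := Real.sqrt_nonneg _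
  have hu2 : u ^ 2 = 1 - w := Real.sq_sqrt (by linarith)
  have hu1 : u < 1 := by nlinarith
  have ht2 : σ ^ 2 * timeLower Δ σ ε ^ 2 = 1 - u := by
    rw [timeLower, ← hw, ← hu, mul_pow, Real.sq_sqrt (by linarith)]
    field_simp
  refine ⟨?_, by linarith, ?_⟩
  · rw [timeLower, ← hw, ← hu]
    have := Real.sqrt_pos.2 (show 0 < 1 - u by linarith)
    positivity
  · have h : σ ^ 2 * timeLower Δ σ ε ^ 2 ≤ σ ^ 2 * (2 / (Δ ^ 2 * ε)) := by
      rw [ht2, show σ ^ 2 * (2 / (Δ ^ 2 * ε)) = w by rw [hw]; ring]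
      -- Since `0 ≤ u ≤ 1`, `u ≥ u² = 1 - w`, so `1 - u ≤ w`.
      nlinarith
    exact le_of_mul_le_mul_left h (by positivity)

lemma coupling_mul_self (ht : t ≠ 0) : coupling Δ σ t * t = 1 / (t ^ 2 * (Δ + σ) ^ 2) := by
  rw [coupling]
  field_simp

/-- `αt ≤ ε` throughout the window. -/
lemma coupling_mul_le (hΔ : 0 < Δ) (hσ : 0 < σ) (ht : 0 < t) (h : 1 ≤ Δ ^ 2 * ε * t ^ 2) :
    coupling Δ σ t * t ≤ ε := by
  rw [coupling_mul_self ht.ne', div_le_iff₀ (by positivity)]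
  have h1 : Δ ^ 2 ≤ (Δ + σ) ^ 2 := by gcongr; linarith
  have hε : 0 < ε := by
    by_contra hneg
    have : Δ ^ 2 * ε * t ^ 2 = Δ ^ 2 * t ^ 2 * ε := by ring
    nlinarith [mul_nonpos_of_nonneg_of_nonpos (by positivity : 0 ≤ Δ ^ 2 * t ^ 2) (not_lt.1 hneg)]
  calc (1 : ℝ) ≤ Δ ^ 2 * ε * t ^ 2 := h
    _ ≤ (Δ + σ) ^ 2 * ε * t ^ 2 := by gcongr
    _ = _ := by ring

lemma sinc_pos {x : ℝ} (h0 : 0 ≤ x) (hx : x < Real.pi) : 0 < Real.sinc x := by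
  rcases h0.eq_or_lt with rfl | h0
  · simp
  · rw [Real.sinc_of_ne_zero h0.ne']
    exact div_pos (Real.sin_pos_of_pos_of_lt_pi h0 hx) h0

lemma half_le_sinc {x : ℝ} (h0 : 0 ≤ x) (hx : x ≤ 1) : 1 / 2 ≤ Real.sinc x := by
  rcases h0.eq_or_lt with rfl | h0
  · simp; norm_num
  · rw [Real.sinc_of_ne_zero h0.ne', le_div_iff₀ h0]
    have := Real.sin_gt_sub_cube h0
    have h3 : x ^ 3 ≤ x := pow_le_of_le_one h0.le hx (by norm_num)
    linarith

/-- The number of interactions suffices for a chain relaxing at rate `α²t²/50`. -/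
lemma log_le_mul_numInteractions (hε : 0 < ε) (hε1 : ε ≤ 1) (ht : 0 < t) (hγ : |Δ - γ| ≤ σ)
    (hσt : σ ^ 2 * t ^ 2 < 2) (ha : 0 < coupling Δ σ t * t) (ha' : coupling Δ σ t * t ≤ ε) :
    Real.log (1 / ε) ≤ (coupling Δ σ t * t) ^ 2 / 50 * numInteractions Δ γ σ ε t := by
  have hσ0 : 0 ≤ σ := (abs_nonneg _).trans hγ
  set a := coupling Δ σ t * t with hadef
  have hx0 : 0 ≤ |Δ - γ| * t / 2 := by positivity
  have hx1 : |Δ - γ| * t / 2 < Real.pi := by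
    have h1 : |Δ - γ| * t ≤ σ * t := by gcongr
    have h2 : σ * t < 2 := by
      by_contra hneg
      nlinarith [not_lt.1 hneg]
    linarith [Real.pi_gt_three]
  have hs0 := sinc_pos hx0 hx1
  have hs1 := Real.sinc_le_one (|Δ - γ| * t / 2)
  set s := Real.sinc (|Δ - γ| * t / 2) with hs
  have hl0 : 0 ≤ Real.log (1 / ε) := Real.log_nonneg (by rw [le_div_iff₀ hε]; linarith)
  have hlog1 : 2 * Real.log (1 / ε) ≤ Real.log (5 / (a ^ 2 * s ^ 2)) := by
    rw [show 2 * Real.log (1 / ε) = Real.log ((1 / ε) ^ 2) by rw [Real.log_pow]; norm_num]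
    refine Real.log_le_log (by positivity) ?_
    rw [div_pow, one_pow, div_le_div_iff₀ (by positivity) (by positivity), one_mul]
    calc a ^ 2 * s ^ 2 ≤ ε ^ 2 * 1 ^ 2 := by gcongr
      _ ≤ 5 * ε ^ 2 := by nlinarith [sq_nonneg ε]
  have hlog2 : Real.log (1 / ε) ≤ Real.log (2 / ε) :=
    Real.log_le_log (by positivity) (by gcongr; norm_num)
  have hlog3 : 0 ≤ Real.log 2 := Real.log_nonneg (by norm_num)
  have hden : 0 < 1 - σ ^ 2 * t ^ 2 / 2 := by linarith
  have hden1 : 1 - σ ^ 2 * t ^ 2 / 2 ≤ 1 := by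
    have : 0 ≤ σ ^ 2 * t ^ 2 := by positivity
    linarith
  -- Of the five logarithms, four come from `2 log(5/(a²s²))`, by `a ≤ ε` and `s ≤ 1`, and one from
  -- `log(2/ε)`. The constant terms are nonnegative and are dropped.
  have hL : 10 / a ^ 2 * (5 * Real.log (1 / ε)) ≤ numInteractions Δ γ σ ε t := by
    refine le_trans ?_ (Nat.le_ceil _)
    rw [← mul_pow, ← hadef, ← hs]
    have h10 : 10 / a ^ 2 ≤ 10 / (a ^ 2 * (1 - σ ^ 2 * t ^ 2 / 2)) := by
      gcongr
      exact mul_le_of_le_one_right (by positivity) hden1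
    refine mul_le_mul h10 (by linarith) (by positivity) (by positivity)
  calc Real.log (1 / ε) = a ^ 2 / 50 * (10 / a ^ 2 * (5 * Real.log (1 / ε))) := by
        field_simp; ring
    _ ≤ _ := by gcongr

/-- The total simulation time at the lower end of the window. -/
lemma numInteractions_mul_timeLower_le (hΔ : 0 < Δ) (hε : 0 < ε) (hε2 : ε ≤ 2) (hσ : 0 < σ)
    (hle : σ ≤ Δ * √(ε / 2)) (hγ : |Δ - γ| ≤ σ) :
    (numInteractions Δ γ σ ε (timeLower Δ σ ε) : ℝ) * timeLower Δ σ ε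
      ≤ 10000000 * (1 + |Real.log ε|) / (Δ * ε ^ (2.5 : ℝ)) := by
  obtain ⟨ht0, hσt, ht2⟩ := timeLower_bounds hσ hε hle
  set t := timeLower Δ σ ε with ht
  have hσΔ : σ ≤ Δ := hle.trans (mul_le_of_le_one_right hΔ.le
    (Real.sqrt_le_one.2 (by linarith)))
  set l := |Real.log ε| with hl
  have hl0 : 0 ≤ l := abs_nonneg _
  set a := coupling Δ σ t * t with hadef
  have ha : a = 1 / (t ^ 2 * (Δ + σ) ^ 2) := coupling_mul_self ht0.ne'
  have ha0 : 0 < a := by rw [ha]; positivity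
  -- Here `1/a = t²(Δ + σ)²`, with `t² ≤ 2/(Δ²ε)` and `σ ≤ Δ`.
  have hainv : 1 / a ^ 2 ≤ 64 / ε ^ 2 := by
    have h1 : t ^ 2 * (Δ + σ) ^ 2 ≤ 2 / (Δ ^ 2 * ε) * (2 * Δ) ^ 2 := by gcongr; linarith
    have h2 : 2 / (Δ ^ 2 * ε) * (2 * Δ) ^ 2 = 8 / ε := by field_simp; norm_num
    rw [ha]
    calc 1 / (1 / (t ^ 2 * (Δ + σ) ^ 2)) ^ 2 = (t ^ 2 * (Δ + σ) ^ 2) ^ 2 := by field_simp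
      _ ≤ (8 / ε) ^ 2 := by rw [← h2]; gcongr
      _ = 64 / ε ^ 2 := by ring
  have hx0 : 0 ≤ |Δ - γ| * t / 2 := by positivity
  have hx1 : |Δ - γ| * t / 2 ≤ 1 := by
    have h1 : |Δ - γ| * t ≤ σ * t := by gcongr
    have h2 : σ * t ≤ 1 := by
      by_contra hneg
      nlinarith [not_le.1 hneg]
    linarith
  have hs := half_le_sinc hx0 hx1
  set s := Real.sinc (|Δ - γ| * t / 2) with hsdef
  have hlogle : Real.log (1 / ε) ≤ l := by
    rw [one_div, Real.log_inv]; exact neg_le_abs _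
  have hlog1 : Real.log (5 / (a ^ 2 * s ^ 2)) ≤ 1280 + 2 * l := by
    have h1 : 5 / (a ^ 2 * s ^ 2) ≤ 1280 * (1 / ε) ^ 2 := by
      calc 5 / (a ^ 2 * s ^ 2) ≤ 5 / (a ^ 2 * (1 / 2) ^ 2) := by gcongr
        _ = 20 * (1 / a ^ 2) := by field_simp; norm_num
        _ ≤ 20 * (64 / ε ^ 2) := by gcongr
        _ = _ := by ring
    have hspos : 0 < s := by linarith
    calc _ ≤ Real.log (1280 * (1 / ε) ^ 2) := Real.log_le_log (by positivity) h1
      _ = Real.log 1280 + 2 * Real.log (1 / ε) := by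
        rw [Real.log_mul (by norm_num) (by positivity), Real.log_pow]; norm_num
      _ ≤ _ := by
        have := Real.log_le_sub_one_of_pos (show (0 : ℝ) < 1280 by norm_num)
        linarith
  have hlog2 : Real.log 2 ≤ 1 := by
    have := Real.log_le_sub_one_of_pos (show (0 : ℝ) < 2 by norm_num); linarith
  have hlog3 : Real.log (2 / ε) ≤ 1 + l := by
    rw [show 2 / ε = 2 * (1 / ε) by ring, Real.log_mul (by norm_num) (by positivity)]
    linarith
  set X := 2 * Real.log (5 / (a ^ 2 * s ^ 2)) + 4 * (1 + Real.log 2) - 1 / 2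
    + Real.log (2 / ε) with hX
  have hXle : X ≤ 2600 * (1 + l) := by linarith
  have hL : (numInteractions Δ γ σ ε t : ℝ) ≤ 1280 / ε ^ 2 * (2600 * (1 + l)) + 1 := by
    have hnum : numInteractions Δ γ σ ε t
        = ⌈10 / (a ^ 2 * (1 - σ ^ 2 * t ^ 2 / 2)) * X⌉₊ := by
      rw [numInteractions, ← mul_pow, ← hadef, ← hsdef]
    have hbound : 10 / (a ^ 2 * (1 - σ ^ 2 * t ^ 2 / 2)) * X ≤ 1280 / ε ^ 2 * (2600 * (1 + l)) := by
      have hden : 1 / 2 ≤ 1 - σ ^ 2 * t ^ 2 / 2 := by linarith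
      have h1 : 10 / (a ^ 2 * (1 - σ ^ 2 * t ^ 2 / 2)) ≤ 1280 / ε ^ 2 := by
        calc 10 / (a ^ 2 * (1 - σ ^ 2 * t ^ 2 / 2)) ≤ 10 / (a ^ 2 * (1 / 2)) := by gcongr
          _ = 20 * (1 / a ^ 2) := by field_simp; norm_num
          _ ≤ 20 * (64 / ε ^ 2) := by gcongr
          _ = _ := by ring
      have h0 : 0 ≤ 10 / (a ^ 2 * (1 - σ ^ 2 * t ^ 2 / 2)) :=
        div_nonneg (by norm_num) (mul_nonneg (sq_nonneg _) (by linarith))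
      exact (mul_le_mul_of_nonneg_left hXle h0).trans
        (mul_le_mul_of_nonneg_right h1 (by positivity))
    rw [hnum]
    exact (Nat.cast_le.2 (Nat.ceil_mono hbound)).trans (Nat.ceil_lt_add_one (by positivity)).le
  have hL' : (numInteractions Δ γ σ ε t : ℝ) ≤ 5000000 * (1 + l) / ε ^ 2 := by
    refine hL.trans ?_
    -- The `+ 1` from rounding up is absorbed here by means of `ε ≤ 2`.
    have h1 : 1 ≤ 4 / ε ^ 2 := by
      rw [le_div_iff₀ (by positivity)]; nlinarith
    calc 1280 / ε ^ 2 * (2600 * (1 + l)) + 1 ≤ 1280 / ε ^ 2 * (2600 * (1 + l)) + 4 / ε ^ 2 := by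
          linarith
      _ = (1280 * 2600 * (1 + l) + 4) / ε ^ 2 := by ring
      _ ≤ _ := by gcongr; linarith
  have htle : t ≤ 2 / (Δ * √ε) := by
    refine (sq_le_sq₀ ht0.le (by positivity)).1 ?_
    rw [div_pow, mul_pow, Real.sq_sqrt hε.le]
    refine ht2.trans ?_
    gcongr
    norm_num
  have hpow : ε ^ (2.5 : ℝ) = ε ^ 2 * √ε := by
    rw [Real.sqrt_eq_rpow, ← Real.rpow_natCast, ← Real.rpow_add hε]; norm_num
  rw [hpow]
  calc _ ≤ 5000000 * (1 + l) / ε ^ 2 * (2 / (Δ * √ε)) := by gcongr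
    _ = _ := by field_simp; norm_num

end Parameters

end Thermalization

end

noncomputable section

namespace Thermalization

/-! ### Thermalization of a qubit -/

section Thermalization

variable {Δ γ σ ε t : ℝ}

/-- A universal threshold below which the perturbative estimates are effective. -/
def smallScale : ℝ := 1 / (100 * (14 + 5 * fourthMoment (Fin 2 × Fin 2)))

lemma smallScale_pos : 0 < smallScale := by
  have := fourthMoment_nonneg (Fin 2 × Fin 2)
  rw [smallScale]; positivity

lemma transitionProb_levels_le {e : Fin 2 → ℝ} (he : e 1 - e 0 = Δ) (hΔ : 0 < Δ) (α : ℝ)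
    (ht : 0 < t) (hε1 : ε ≤ 1) (hγ : Δ / 2 ≤ γ) (h : 1 ≤ Δ ^ 2 * ε * t ^ 2)
    (ha0 : 0 < α * t) (ha : α * t ≤ ε) {a b : Fin 2 × Fin 2} (hab : a ≠ b)
    (h1 : (a, b) ≠ ((1, 0), (0, 1))) (h2 : (a, b) ≠ ((0, 1), (1, 0))) :
    transitionProb (levels e γ) α t a b
      ≤ (α * t) ^ 2 * (ε * (7 + 2 * fourthMoment (Fin 2 × Fin 2))) := by
  set K := fourthMoment (Fin 2 × Fin 2)
  have hK : 0 ≤ K := fourthMoment_nonneg _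
  -- Once the resonant pairs are excluded, the energy differences are, up to sign, `Δ`, `γ` and `Δ +
  -- γ`.
  have hω : Δ / 2 ≤ |levels e γ a - levels e γ b| := by
    obtain ⟨a1, a2⟩ := a
    obtain ⟨b1, b2⟩ := b
    simp only [levels]
    fin_cases a1 <;> fin_cases a2 <;> fin_cases b1 <;> fin_cases b2 <;> simp at hab h1 h2 ⊢ <;>
      first
      | (refine le_trans ?_ (le_abs_self _); linarith)
      | (refine le_trans ?_ (neg_le_abs _); linarith)
  set ω := levels e γ a - levels e γ b
  have hω0 : ω ≠ 0 := by
    intro h0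
    rw [h0, abs_zero] at hω
    linarith
  have hφ : ‖phaseIntegral ω t‖ ^ 2 ≤ 16 * (ε * t ^ 2) := by
    have h3 : ‖phaseIntegral ω t‖ ≤ 4 / Δ := by
      refine (norm_phaseIntegral_le_two_div hω0 t).trans ?_
      rw [div_le_div_iff₀ (by linarith) hΔ]
      linarith
    calc _ ≤ (4 / Δ) ^ 2 := by gcongr
      _ = 16 / Δ ^ 2 * 1 := by ring
      _ ≤ 16 / Δ ^ 2 * (Δ ^ 2 * ε * t ^ 2) := by gcongr
      _ = _ := by field_simp
  have hP := transitionProb_le (levels e γ) α ht.le hab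
  have hcard : (1 : ℝ) / (Fintype.card (Fin 2 × Fin 2) + 1) = 1 / 5 := by simp; norm_num
  rw [hcard] at hP
  have hε0 : 0 ≤ ε := ha0.le.trans ha
  have ha2 : (α * t) ^ 2 ≤ ε := by nlinarith
  calc _ ≤ 2 * (α ^ 2 * (16 * (ε * t ^ 2))) * (1 / 5) + 2 * (α * t) ^ 4 * K :=
        hP.trans (by gcongr)
    _ = (α * t) ^ 2 * (32 / 5 * ε + 2 * (α * t) ^ 2 * K) := by ring
    _ ≤ (α * t) ^ 2 * (32 / 5 * ε + 2 * ε * K) := by gcongr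
    _ ≤ _ := by
      gcongr
      linarith

/-- A crude bound valid on resonance too. It serves to keep the total rate at most `1`, so that the
chain contracts without overshooting. -/
lemma transitionProb_le_of_ne {n : Type*} [Fintype n] [DecidableEq n] (E : n → ℝ) (α : ℝ)
    (ht : 0 ≤ t) {a b : n} (hab : a ≠ b) (h : (α * t) ^ 2 ≤ 1) :
    transitionProb E α t a b ≤ (α * t) ^ 2 * (2 + 2 * fourthMoment n) := by
  have hK : 0 ≤ fourthMoment n := fourthMoment_nonneg _
  have hcard : (1 : ℝ) / (Fintype.card n + 1) ≤ 1 := by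
    rw [div_le_one (by positivity)]
    have : (0 : ℝ) ≤ Fintype.card n := by positivity
    linarith
  calc _ ≤ 2 * (α ^ 2 * t ^ 2) * 1 + 2 * (α * t) ^ 4 * fourthMoment n := by
        refine (transitionProb_le E α ht hab).trans ?_
        gcongr
        exact norm_phaseIntegral_le _ ht
    _ = (α * t) ^ 2 * (2 + 2 * (α * t) ^ 2 * fourthMoment n) := by ring
    _ ≤ (α * t) ^ 2 * (2 + 2 * 1 * fourthMoment n) := by gcongr
    _ = _ := by ring

/-- The detuning satisfies `|Δ - γ|t ≤ σt < √2`, so the phase integral is at least `2t/3`; the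
constant is `2/45 = (1/2)(2/3)²(1/5)`. -/
lemma le_transitionProb_resonant {e : Fin 2 → ℝ} (he : e 1 - e 0 = Δ) (α : ℝ)
    (ht : 0 < t) (hε1 : ε ≤ 1) (hγ : |Δ - γ| ≤ σ) (hσt : σ ^ 2 * t ^ 2 < 2)
    (ha0 : 0 < α * t) (ha : α * t ≤ ε) :
    (α * t) ^ 2 * (2 / 45 - ε * fourthMoment (Fin 2 × Fin 2))
      ≤ transitionProb (levels e γ) α t (1, 0) (0, 1) := by
  set K := fourthMoment (Fin 2 × Fin 2)
  have hK : 0 ≤ K := fourthMoment_nonneg _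
  have hω : levels e γ (1, 0) - levels e γ (0, 1) = Δ - γ := by
    simp [levels]; linarith
  have hres : ((Δ - γ) * t) ^ 2 ≤ 2 := by
    have : (Δ - γ) ^ 2 ≤ σ ^ 2 := sq_le_sq.2 (hγ.trans (le_abs_self _))
    rw [mul_pow]
    nlinarith [sq_nonneg t]
  have hφ := le_norm_phaseIntegral ht.le hres
  have hP := le_transitionProb (levels e γ) α ht.le
    (show ((1, 0) : Fin 2 × Fin 2) ≠ (0, 1) by decide)
  have hcard : (1 : ℝ) / (Fintype.card (Fin 2 × Fin 2) + 1) = 1 / 5 := by simp; norm_num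
  rw [hcard, hω] at hP
  have ha2 : (α * t) ^ 2 ≤ ε := by nlinarith
  refine le_trans ?_ hP
  calc (α * t) ^ 2 * (2 / 45 - ε * K) ≤ (α * t) ^ 2 * (2 / 45 - (α * t) ^ 2 * K) := by gcongr
    _ = 1 / 2 * (α ^ 2 * (2 / 3 * t) ^ 2) * (1 / 5) - (α * t) ^ 4 * K := by ring
    _ ≤ _ := by gcongr

/-- The populations converge to those of the environment up to `O(ε)`. -/
lemma abs_iterate_sub_sigmoid_le {e : Fin 2 → ℝ} (he : e 1 - e 0 = Δ) {β p : ℝ}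
    (hp : p ∈ Set.Icc (0 : ℝ) 1) (hε : 0 < ε) (hsmall : ε ≤ smallScale) (hσ : 0 < σ)
    (hγ : |Δ - γ| ≤ σ) (hle : σ ≤ Δ * √(ε / 2))
    (ht : t ∈ Set.Icc (timeLower Δ σ ε) (timeUpper Δ σ ε)) :
    |(chainStep
        (excitationRate (transitionProb (levels e γ) (coupling Δ σ t) t) (Real.sigmoid (-(β * γ))))
        (relaxationRate (transitionProb (levels e γ) (coupling Δ σ t) t) (Real.sigmoid (-(β * γ)))))^[
          numInteractions Δ γ σ ε t] p - Real.sigmoid (-(β * γ))|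
      ≤ (1 + 200 * (7 + 2 * fourthMoment (Fin 2 × Fin 2))) * ε := by
  have hΔ := pos_of_le_mul_sqrt hσ hle
  obtain ⟨ht0, hσt, hwin⟩ := window_bounds hσ hε hle ht
  set K := fourthMoment (Fin 2 × Fin 2) with hKdef
  have hK : 0 ≤ K := fourthMoment_nonneg _
  -- The threshold is tuned to `K + 2(7 + 2K) = 14 + 5K`: the total rate is at least `a²(2/45 - ε(14
  -- + 5K)) ≥ a²(2/45 - 1/100)`, which exceeds `a²/50`. It also gives `γ ≥ Δ/2` and a total rate at
  -- most `1`.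
  have hεK : ε * (100 * (14 + 5 * K)) ≤ 1 := by
    rw [smallScale, le_div_iff₀ (by positivity)] at hsmall
    exact hsmall
  have hεK0 : 0 ≤ ε * K := by positivity
  have hε1 : ε ≤ 1 := by linarith
  have hwin' : 1 ≤ Δ ^ 2 * ε * t ^ 2 := by
    refine hwin.trans ?_
    gcongr
    refine mul_le_of_le_one_right (by positivity) ?_
    have : 0 ≤ σ ^ 2 * t ^ 2 := by positivity
    linarith
  have hγ2 : Δ / 2 ≤ γ := by
    have h1 : √(ε / 2) ≤ 1 / 2 := Real.sqrt_le_iff.2 ⟨by norm_num, by linarith⟩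
    have h2 : Δ * √(ε / 2) ≤ Δ * (1 / 2) := by gcongr
    linarith [(abs_le.1 hγ).2]
  set α := coupling Δ σ t with hα
  have ha0 : 0 < α * t := by rw [hα, coupling_mul_self ht0.ne']; positivity
  have ha : α * t ≤ ε := coupling_mul_le hΔ hσ ht0 hwin'
  have ha2 : (α * t) ^ 2 ≤ ε := by nlinarith
  set P := transitionProb (levels e γ) α t with hP
  set s := Real.sigmoid (-(β * γ)) with hs
  have hsmem : s ∈ Set.Icc (0 : ℝ) 1 := ⟨Real.sigmoid_nonneg _, Real.sigmoid_le_one _⟩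
  set η := (α * t) ^ 2 * (ε * (7 + 2 * K)) with hη
  have hη0 : 0 ≤ η := by positivity
  obtain ⟨hlow, hupp, hdrift⟩ := rate_bounds (P := P) (transitionProb_nonneg _ _ _)
    (sum_transitionProb_left _ _ _) (sum_transitionProb_right _ _ _) hsmem (η := η)
    (fun a b hab h1 h2 => transitionProb_levels_le he hΔ α ht0 hε1 hγ2 hwin' ha0 ha hab h1 h2)
  have hres : (α * t) ^ 2 * (2 / 45 - ε * K) ≤ P (1, 0) (0, 1) :=
    le_transitionProb_resonant he α ht0 hε1 hγ hσt ha0 ha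
  have hR1 := transitionProb_le_of_ne (levels e γ) α ht0.le
    (show ((1, 0) : Fin 2 × Fin 2) ≠ (0, 1) by decide) (ha2.trans hε1)
  have hR2 := transitionProb_le_of_ne (levels e γ) α ht0.le
    (show ((0, 1) : Fin 2 × Fin 2) ≠ (1, 0) by decide) (ha2.trans hε1)
  rw [← hP, ← hKdef] at hR1 hR2
  set r := (α * t) ^ 2 / 50 with hr
  have hr0 : 0 < r := by positivity
  have hrle : r ≤ excitationRate P s + relaxationRate P s := by
    refine le_trans ?_ hlow
    have h1 : (α * t) ^ 2 * (1 / 50) ≤ (α * t) ^ 2 * (2 / 45 - ε * K - 2 * (ε * (7 + 2 * K))) := by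
      gcongr
      linarith
    linarith
  have hle1 : excitationRate P s + relaxationRate P s ≤ 1 := by
    refine hupp.trans ?_
    have h1 : (α * t) ^ 2 * (4 + 4 * K + 4 * (ε * (7 + 2 * K)))
        ≤ ε * (4 + 4 * K + 4 * (1 * (7 + 2 * K))) := by gcongr
    linarith
  have hconv := abs_iterate_chainStep_sub_le hr0 hrle hle1 hdrift p (numInteractions Δ γ σ ε t)
  -- The factor `a²` cancels between drift and rate, so the stationary error is `O(ε)` however weak
  -- the coupling is.
  refine hconv.trans ?_
  have hδ : 4 * η / r = 200 * (7 + 2 * K) * ε := by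
    rw [div_eq_iff hr0.ne', hη, hr]; ring
  have hr1 : r ≤ 1 := hrle.trans hle1
  have hdist : |p - s| ≤ 1 := abs_le.2 ⟨by linarith [hp.1, hsmem.2], by linarith [hp.2, hsmem.1]⟩
  have hpow : (1 - r) ^ numInteractions Δ γ σ ε t ≤ ε := by
    have hlog := log_le_mul_numInteractions hε hε1 ht0 hγ hσt ha0 ha
    calc (1 - r) ^ numInteractions Δ γ σ ε t
        ≤ Real.exp (-r) ^ numInteractions Δ γ σ ε t := by
          exact pow_le_pow_left₀ (by linarith) (Real.one_sub_le_exp_neg r) _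
      _ = Real.exp (-(r * numInteractions Δ γ σ ε t)) := by rw [← Real.exp_nat_mul]; ring_nf
      _ ≤ Real.exp (-Real.log (1 / ε)) := by gcongr
      _ = ε := by rw [one_div, Real.log_inv, neg_neg, Real.exp_log hε]
  rw [hδ]
  have h0 : 0 ≤ (1 - r) ^ numInteractions Δ γ σ ε t := pow_nonneg (by linarith) _
  nlinarith [mul_le_of_le_one_right h0 hdist]

/-- The trace distance to the thermal state, in terms of the two-level Markov chain. -/
lemma exists_traceNorm_gibbs_sub_iterate_le {HS ρ : Matrix (Fin 2) (Fin 2) ℂ}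
    (hHS : HS.IsHermitian) (hΔ : 0 < qubitGap hHS) (hρ : IsDensityMatrix ρ) (hc : Commute ρ HS)
    (γ α β t : ℝ) (L : ℕ) :
    ∃ e : Fin 2 → ℝ, e 1 - e 0 = qubitGap hHS ∧ ∃ p ∈ Set.Icc (0 : ℝ) 1,
      traceNorm (gibbs HS β - (channel HS (envHamiltonian γ) α β t)^[L] ρ)
        ≤ 2 * |Real.sigmoid (-(β * qubitGap hHS)) -
          (chainStep
            (excitationRate (transitionProb (levels e γ) α t) (Real.sigmoid (-(β * γ))))
            (relaxationRate (transitionProb (levels e γ) α t) (Real.sigmoid (-(β * γ)))))^[L] p| := by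
  obtain ⟨V, hV, e, he, hdiag⟩ := exists_diagonalization hHS
  have hne : e 0 ≠ e 1 := by
    intro h
    rw [h, sub_self] at he
    linarith
  obtain ⟨p, hp, hpop⟩ := exists_populations hV hne hρ (hdiag ▸ hc)
  refine ⟨e, he, p, hp, ?_⟩
  have hg : gibbs HS β = V * gibbs (Matrix.diagonal fun i => (e i : ℂ)) β * Vᴴ := by
    rw [hdiag, gibbs_conj hV]
  have hit := iterate_channel hV e γ α β t p L
  rw [← hdiag, ← hpop] at hit
  rw [hit, hg, gibbs_diagonal, he, ← sub_mul, ← mul_sub, Matrix.diagonal_sub]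
  refine le_trans (le_of_eq ?_) (traceNorm_conj_diagonal_le hV _)
  congr 4
  ext i
  rw [← Complex.ofReal_sub]
  congr 1
  fin_cases i
  · simp
  · simp

/-- The universal constant of the error bound. -/
def errorConstant : ℝ :=
  2 * (2 + 200 * (7 + 2 * fourthMoment (Fin 2 × Fin 2))) + 2 / smallScale

lemma traceNorm_gibbs_sub_iterate_le {HS ρ : Matrix (Fin 2) (Fin 2) ℂ}
    (hHS : HS.IsHermitian) {β : ℝ} (hΔ : qubitGap hHS = Δ) (hρ : IsDensityMatrix ρ)
    (hc : Commute ρ HS) (hβ : 0 ≤ β) (hε : 0 < ε) (hσ : 0 < σ) (hγ : |Δ - γ| ≤ σ)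
    (hβσ : 2 * β * σ ≤ ε) (hle : σ ≤ Δ * √(ε / 2))
    (ht : t ∈ Set.Icc (timeLower Δ σ ε) (timeUpper Δ σ ε)) :
    traceNorm (gibbs HS β -
        (channel HS (envHamiltonian γ) (coupling Δ σ t) β t)^[numInteractions Δ γ σ ε t] ρ)
      ≤ errorConstant * ε := by
  have hΔ0 := pos_of_le_mul_sqrt hσ hle
  have hK := fourthMoment_nonneg (Fin 2 × Fin 2)
  have hs := smallScale_pos
  obtain ⟨e, he, p, hp, hbound⟩ := exists_traceNorm_gibbs_sub_iterate_le hHS (hΔ ▸ hΔ0) hρ hc γ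
    (coupling Δ σ t) β t (numInteractions Δ γ σ ε t)
  rw [hΔ] at he hbound
  refine hbound.trans ?_
  set g := Real.sigmoid (-(β * Δ)) with hg
  set s := Real.sigmoid (-(β * γ)) with hsdef
  -- Below the threshold the perturbative bound applies. Above it, both populations lie in `[0, 1]`,
  -- so the error is at most `2`, and the summand `2 / smallScale` of the constant covers it.
  rcases le_total ε smallScale with hsmall | hlarge
  · have h1 := abs_iterate_sub_sigmoid_le he (β := β) hp hε hsmall hσ hγ hle ht
    have h2 : |g - s| ≤ ε := by
      refine (abs_sigmoid_sub_le _ _).trans ?_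
      rw [show -(β * Δ) - -(β * γ) = -(β * (Δ - γ)) by ring, abs_neg, abs_mul, abs_of_nonneg hβ]
      have h3 : β * |Δ - γ| ≤ β * σ := by gcongr
      linarith [mul_nonneg hβ hσ.le]
    have h3 := abs_sub_le g s ((chainStep
      (excitationRate (transitionProb (levels e γ) (coupling Δ σ t) t) s)
      (relaxationRate (transitionProb (levels e γ) (coupling Δ σ t) t) s))^[
        numInteractions Δ γ σ ε t] p)
    rw [abs_sub_comm s] at h3
    have h4 : 0 ≤ 2 / smallScale * ε := by positivity
    rw [errorConstant, add_mul]
    linarith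
  · have hsmem : s ∈ Set.Icc (0 : ℝ) 1 := ⟨Real.sigmoid_nonneg _, Real.sigmoid_le_one _⟩
    have hmem := iterate_chainStep_mem_Icc
      (excitationRate_mem_Icc (transitionProb_nonneg (levels e γ) (coupling Δ σ t) t)
        (sum_transitionProb_left _ _ _) hsmem)
      (relaxationRate_mem_Icc (transitionProb_nonneg (levels e γ) (coupling Δ σ t) t)
        (sum_transitionProb_left _ _ _) hsmem) hp (numInteractions Δ γ σ ε t)
    have h1 : |g - (chainStep
        (excitationRate (transitionProb (levels e γ) (coupling Δ σ t) t) s)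
        (relaxationRate (transitionProb (levels e γ) (coupling Δ σ t) t) s))^[
          numInteractions Δ γ σ ε t] p| ≤ 1 :=
      abs_le.2 ⟨by linarith [hmem.2, Real.sigmoid_nonneg (-(β * Δ))],
        by linarith [hmem.1, Real.sigmoid_le_one (-(β * Δ))]⟩
    have h2 : 2 ≤ 2 / smallScale * ε := by
      rw [div_mul_eq_mul_div, le_div_iff₀ hs]
      linarith
    have h3 : 0 ≤ 2 * (2 + 200 * (7 + 2 * fourthMoment (Fin 2 × Fin 2))) * ε := by positivity
    rw [errorConstant, add_mul]
    linarith

end Thermalization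

end Thermalization

end

theorem mainTheorem5 :
    ∃ (C : ℝ) (k : ℕ), 0 < C ∧
      -- Thermalization: the trace distance is `Õ(ε)`.
      (∀ (HS : Matrix (Fin 2) (Fin 2) ℂ) (hHS : HS.IsHermitian) (ρ : Matrix (Fin 2) (Fin 2) ℂ)
        (Δ β ε σ γ t : ℝ),
        qubitGap hHS = Δ → IsDensityMatrix ρ → Commute ρ HS →
        0 ≤ β → 0 < ε → 0 < σ →
        -- The window `[γ - σ, γ + σ]` contains the gap.
        |Δ - γ| ≤ σ →
        -- `σ ≤ min {ε / (2β), Δ √(ε / 2)}`, with `ε / (2β) = ∞` for `β = 0`.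
        2 * β * σ ≤ ε → σ ≤ Δ * √(ε / 2) →
        t ∈ Set.Icc (timeLower Δ σ ε) (timeUpper Δ σ ε) →
        traceNorm (gibbs HS β -
            (channel HS (envHamiltonian γ) (coupling Δ σ t) β t)^[numInteractions Δ γ σ ε t] ρ)
          ≤ C * ε * (1 + |Real.log ε|) ^ k) ∧
      -- Total simulation time in the limit `σ → 0`, for the smallest admissible `t`.
      (∀ Δ ε : ℝ, 0 < Δ → 0 < ε → ε ≤ 2 → ∀ᶠ σ in 𝓝[>] (0 : ℝ), ∀ γ : ℝ, |Δ - γ| ≤ σ →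
        (numInteractions Δ γ σ ε (timeLower Δ σ ε) : ℝ) * timeLower Δ σ ε
          ≤ C * (1 + |Real.log ε|) ^ k / (Δ * ε ^ (2.5 : ℝ))) := by
  have hC : 0 < errorConstant := by
    have := fourthMoment_nonneg (Fin 2 × Fin 2)
    have := smallScale_pos
    rw [errorConstant]
    positivity
  -- The sum of the two constants serves both statements. The error bound is a pure `O(ε)`; the
  -- logarithm is needed only for the simulation time.
  refine ⟨errorConstant + 10000000, 1, by positivity, ?_, ?_⟩
  · intro HS hHS ρ Δ β ε σ γ t hΔ hρ hc hβ hε hσ hγ hβσ hle ht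
    refine (traceNorm_gibbs_sub_iterate_le hHS hΔ hρ hc hβ hε hσ hγ hβσ hle ht).trans ?_
    rw [pow_one]
    have hl : 0 ≤ |Real.log ε| := abs_nonneg _
    calc errorConstant * ε = errorConstant * ε * 1 := by ring
      _ ≤ (errorConstant + 10000000) * ε * (1 + |Real.log ε|) := by gcongr <;> linarith
  · intro Δ ε hΔ hε hε2
    have hpos : 0 < Δ * √(ε / 2) := mul_pos hΔ (Real.sqrt_pos.2 (by linarith))
    -- Small enough means `σ ≤ Δ√(ε/2)`, which keeps the argument of the inner square root of `t_-`
    -- nonnegative.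
    filter_upwards [Ioc_mem_nhdsGT hpos] with σ hσ γ hγ
    refine (numInteractions_mul_timeLower_le hΔ hε hε2 hσ.1 hσ.2 hγ).trans ?_
    rw [pow_one]
    gcongr
    linarith
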